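/- Let $T=\mathbb{C}/\Lambda$ be an elliptic curve, $\Lambda=\mathbb{Z}\omega_0+\mathbb{Z}\omega_1$ with $\omega_0,\omega_1$ linearly independent over $\mathbb{R}$, and give $T\times\mathbb{C}$ (coordinates $z,w$) the flat product metric. Let $V^*=\mathrm{Hom}_{\mathbb{R}}(\mathbb{C},\mathbb{R})$, let $\Lambda^*=\{\xi\in V^* : \xi(\Lambda)\subset 2\pi\mathbb{Z}\}$, and let $\hat T=V^*/\Lambda^*$ be the dual torus. For $\xi\in V^*$ let $L_\xi$ be the trivial smooth line bundle over $T\times\mathbb{C}$ with the flat unitary connection $\nabla=d-i\xi$ pulled back from $T$. Put $S^-\otimes L_\xi=\Lambda^{0,1}(L_\xi)$ and $S^+\otimes L_\xi=\Lambda^{0,0}(L_\xi)\oplus\Lambda^{0,2}(L_\xi)$, and let $$D_\xi^*=\sqrt2\,\bigl(-\bar\partial_\xi^{\,*}+\bar\partial_\xi\bigr):\Gamma(L_\xi\otimes S^-)\to\Gamma(L_\xi\otimes S^+)$$ be the coupled Dirac operator on the compactly supported smooth sections $\Gamma$. In the unitary frames $d\bar z/\sqrt2,\ d\bar w/\sqrt2$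 of $S^-$ and $1,\ (d\bar z\wedge d\bar w)/2$ of $S^+$ it is $$D_\xi^*(a,b)=\bigl(2\nabla_z a+2\nabla_w b,\ 2\nabla_{\bar z}b-2\nabla_{\bar w}a\bigr).$$ Let $L^2_1(L_\xi\otimes S^-)$ be the completion of $\Gamma(L_\xi\otimes S^-)$ with respect to the norm $\|s\|_{L^2_1}=\|s\|_{L^2}+\|D_\xi^*s\|_{L^2}$, and extend $D_\xi^*$ by continuity to a bounded operator $$D_\xi^*:L^2_1(L_\xi\otimes S^-)\to L^2(L_\xi\otimes S^+).$$ **Proposition.** If the class of $\xi$ in $\hat T$ is nontrivial, then this operator is invertible: there is a bounded linear operator $Q_\xi^\infty:L^2(L_\xi\otimes S^+)\to L^2_1(L_\xi\otimes S^-)$ with $D_\xi^*Q_\xi^\infty=\mathrm{id}$ and $Q_\xi^\infty D_\xi^*=\mathrm{id}$. -/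

import Mathlib

namespace FlatModel

noncomputable section

open MeasureTheory UniformSpace
open scoped ContDiff

variable (Ω : Module.Basis (Fin 2) ℝ ℂ)

/-! ### The torus, its dual, and the four-manifold -/

/-- The period lattice `ℤ Ω₀ + ℤ Ω₁ ⊂ ℂ`. -/
abbrev lattice : AddSubgroup ℂ := (Submodule.span ℤ (Set.range Ω)).toAddSubgroup

/-- The elliptic curve `T = ℂ / (ℤ Ω₀ + ℤ Ω₁)`. -/
abbrev Torus : Type := ℂ ⧸ lattice Ω

/-- The four-manifold `T × ℂ`, with coordinates `(z, w)`. -/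
abbrev Space : Type := Torus Ω × ℂ

/-- The area measure of the flat metric of `T` (the image of Lebesgue measure on a fundamental
parallelogram). -/
instance torusMeasureSpace : MeasureSpace (Torus Ω) where
  volume := (volume.restrict (ZSpan.fundamentalDomain Ω)).map (QuotientAddGroup.mk)

/-- The dual lattice: the real covectors whose periods all lie in `2πℤ`. -/
def dualLattice : AddSubgroup (ℂ →L[ℝ] ℝ) where
  carrier := {ξ | ∀ l ∈ lattice Ω, ∃ n : ℤ, ξ l = 2 * Real.pi * n}
  zero_mem' := fun _ _ => ⟨0, by simp⟩
  add_mem' := by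
    intro a b ha hb l hl
    obtain ⟨m, hm⟩ := ha l hl
    obtain ⟨n, hn⟩ := hb l hl
    exact ⟨m + n, by rw [add_apply, hm, hn]; push_cast; ring⟩
  neg_mem' := by
    intro a ha l hl
    obtain ⟨m, hm⟩ := ha l hl
    exact ⟨-m, by rw [neg_apply, hm]; push_cast; ring⟩

/-- The dual torus. The covector `ξ` represents the flat line bundle `L_ξ`, which is the trivial
smooth line bundle with the connection `d - iξ`; two covectors give gauge equivalent
connections exactly when they differ by an element of the dual lattice. -/
abbrev DualTorus : Type := (ℂ →L[ℝ] ℝ) ⧸ dualLattice Ω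

/-! ### Sections and the coupled Dirac operator -/

variable {Ω}

/-- The lift of a function on `T × ℂ` to the universal cover `ℂ × ℂ`. -/
def lift {F : Type*} (f : Space Ω → F) (q : ℂ × ℂ) : F := f ((q.1 : Torus Ω), q.2)

/-- The directional derivative along the constant vector field `v` on `T × ℂ`. -/
def dirDeriv (v : ℂ × ℂ) (f : Space Ω → ℂ) (p : Space Ω) : ℂ :=
  deriv (fun t : ℝ => f (p + (((t • v.1 : ℂ) : Torus Ω), t • v.2))) 0

/-- The covariant derivative along `v` for the pull-back to `T × ℂ` of the constant
connection `d - iξ` on `L_ξ → T`. -/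
def covDeriv (ξ : ℂ →L[ℝ] ℝ) (v : ℂ × ℂ) (f : Space Ω → ℂ) (p : Space Ω) : ℂ :=
  dirDeriv v f p - Complex.I * (ξ v.1 : ℂ) * f p

/-- `∇_z = (∇_x - i ∇_y) / 2` for `z = x + iy` the torus coordinate. -/
def nablaZ (ξ : ℂ →L[ℝ] ℝ) (f : Space Ω → ℂ) (p : Space Ω) : ℂ :=
  (covDeriv ξ (1, 0) f p - Complex.I * covDeriv ξ (Complex.I, 0) f p) / 2

/-- `∇_z̄ = (∇_x + i ∇_y) / 2` for `z = x + iy` the torus coordinate. -/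
def nablaZbar (ξ : ℂ →L[ℝ] ℝ) (f : Space Ω → ℂ) (p : Space Ω) : ℂ :=
  (covDeriv ξ (1, 0) f p + Complex.I * covDeriv ξ (Complex.I, 0) f p) / 2

/-- `∇_w = (∇_u - i ∇_v) / 2` for `w = u + iv` the plane coordinate. -/
def nablaW (ξ : ℂ →L[ℝ] ℝ) (f : Space Ω → ℂ) (p : Space Ω) : ℂ :=
  (covDeriv ξ (0, 1) f p - Complex.I * covDeriv ξ (0, Complex.I) f p) / 2

/-- `∇_w̄ = (∇_u + i ∇_v) / 2` for `w = u + iv` the plane coordinate. -/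
def nablaWbar (ξ : ℂ →L[ℝ] ℝ) (f : Space Ω → ℂ) (p : Space Ω) : ℂ :=
  (covDeriv ξ (0, 1) f p + Complex.I * covDeriv ξ (0, Complex.I) f p) / 2

/-- The fibre `ℂ²` of `L_ξ ⊗ S⁻ = Λ^{0,1}(L_ξ)` in the unitary parallel frame
`dz̄/√2, dw̄/√2`, and of `L_ξ ⊗ S⁺ = Λ^{0,0}(L_ξ) ⊕ Λ^{0,2}(L_ξ)` in the unitary parallel frame
`1, (dz̄ ∧ dw̄)/2`. -/
abbrev Spinor : Type := EuclideanSpace ℂ (Fin 2)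

/-- The coupled Dirac operator `D*_ξ = √2 (-∂̄_ξ^* + ∂̄_ξ)` from `L_ξ ⊗ S⁻` to `L_ξ ⊗ S⁺`, i.e. the
matrix with rows `(-∂̄^{(z),*}, -∂̄^{(w),*})` and `(∂̄^{(w)}, ∂̄^{(z)})`. In the frames above
`-∂̄_ξ^* (a, b) = √2 (∇_z a + ∇_w b)` and `∂̄_ξ (a, b) = √2 (∇_z̄ b - ∇_w̄ a)`, the minus sign being
that of `dw̄ ∧ dz̄ = - dz̄ ∧ dw̄`. -/
def diracFun (ξ : ℂ →L[ℝ] ℝ) (s : Space Ω → Spinor) (p : Space Ω) : Spinor :=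
  !₂[2 * nablaZ ξ (fun q => s q 0) p + 2 * nablaW ξ (fun q => s q 1) p,
     2 * nablaZbar ξ (fun q => s q 1) p - 2 * nablaWbar ξ (fun q => s q 0) p]

variable (Ω) in
/-- The compactly supported smooth sections over `T × ℂ` of a bundle trivialised by a frame, with
fibre `ℂ²`. -/
def Sections : Submodule ℂ (Space Ω → Spinor) where
  carrier := {s | ContDiff ℝ ∞ (lift s) ∧ HasCompactSupport s}
  zero_mem' := ⟨contDiff_const, HasCompactSupport.zero⟩
  add_mem' := fun ha hb => ⟨ha.1.add hb.1, ha.2.add hb.2⟩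
  smul_mem' := fun c _ hs => ⟨hs.1.const_smul c, hs.2.smul_left (f := fun _ => c)⟩

/-! ### Facts that make the operator act on sections -/

lemma dirDeriv_lift (v : ℂ × ℂ) (f : Space Ω → ℂ) (q : ℂ × ℂ) :
    lift (dirDeriv v f) q = lineDeriv ℝ (lift f) q v := by
  simp only [lift, dirDeriv, lineDeriv]
  rfl

lemma contDiff_dirDeriv (v : ℂ × ℂ) {f : Space Ω → ℂ} (hf : ContDiff ℝ ∞ (lift f)) :
    ContDiff ℝ ∞ (lift (dirDeriv v f)) := by
  have h : lift (dirDeriv v f) = fun q => fderiv ℝ (lift f) q v := by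
    funext q
    rw [dirDeriv_lift]
    exact ((hf.differentiable (by simp)) q).lineDeriv_eq_fderiv
  rw [h]
  exact (hf.fderiv_right (m := ∞) (by simp)).clm_apply contDiff_const

lemma contDiff_covDeriv (ξ : ℂ →L[ℝ] ℝ) (v : ℂ × ℂ) {f : Space Ω → ℂ}
    (hf : ContDiff ℝ ∞ (lift f)) : ContDiff ℝ ∞ (lift (covDeriv ξ v f)) :=
  (contDiff_dirDeriv v hf).sub (contDiff_const.mul hf)

lemma continuous_of_lift {F : Type*} [TopologicalSpace F] {f : Space Ω → F}
    (hf : Continuous (lift f)) : Continuous f := by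
  have hq : IsOpenQuotientMap
      (Prod.map (QuotientAddGroup.mk : ℂ → Torus Ω) (id : ℂ → ℂ)) :=
    QuotientAddGroup.isOpenQuotientMap_mk.prodMap IsOpenQuotientMap.id
  exact hq.isQuotientMap.continuous_iff.2 hf

lemma dirDeriv_eq_zero (v : ℂ × ℂ) (f : Space Ω → ℂ) (p : Space Ω)
    (hp : p ∉ tsupport f) : dirDeriv v f p = 0 := by
  have hc : Continuous
      (fun t : ℝ => p + ((((t • v.1 : ℂ) : Torus Ω), t • v.2) : Space Ω)) :=
    continuous_const.add
      ((QuotientAddGroup.continuous_mk.comp (continuous_id.smul continuous_const)).prodMk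
        (continuous_id.smul continuous_const))
  have h0 : p + (((((0 : ℝ) • v.1 : ℂ) : Torus Ω), (0 : ℝ) • v.2) : Space Ω) = p := by
    ext <;> simp
  have hz := notMem_tsupport_iff_eventuallyEq.1 hp
  have h1 : Filter.Tendsto (fun t : ℝ => p + ((((t • v.1 : ℂ) : Torus Ω), t • v.2) : Space Ω))
      (nhds 0) (nhds p) := by
    have := hc.tendsto 0
    rwa [h0] at this
  have h2 : (fun t : ℝ => f (p + ((((t • v.1 : ℂ) : Torus Ω), t • v.2) : Space Ω)))
      =ᶠ[nhds 0] fun _ => (0 : ℂ) := h1.eventually hz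
  rw [dirDeriv, h2.deriv_eq]
  simp

lemma covDeriv_eq_zero (ξ : ℂ →L[ℝ] ℝ) (v : ℂ × ℂ) (f : Space Ω → ℂ) (p : Space Ω)
    (hp : p ∉ tsupport f) : covDeriv ξ v f p = 0 := by
  rw [covDeriv, dirDeriv_eq_zero v f p hp, image_eq_zero_of_notMem_tsupport hp]
  simp

lemma contDiff_coord {s : Space Ω → Spinor} (hs : ContDiff ℝ ∞ (lift s)) (i : Fin 2) :
    ContDiff ℝ ∞ (lift (fun q => s q i)) :=
  (contDiff_piLp (𝕜 := ℝ) 2 (f := lift s)).1 hs i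

lemma tsupport_coord (s : Space Ω → Spinor) (i : Fin 2) :
    tsupport (fun q => s q i) ⊆ tsupport s := by
  refine closure_mono fun q hq => ?_
  contrapose! hq
  simp only [Function.mem_support, not_not] at hq ⊢
  simp [hq]

lemma diracFun_mem (ξ : ℂ →L[ℝ] ℝ) {s : Space Ω → Spinor} (hs : s ∈ Sections Ω) :
    diracFun ξ s ∈ Sections Ω := by
  constructor
  · refine (contDiff_piLp (𝕜 := ℝ) 2 (f := lift (diracFun ξ s))).2 fun i => ?_
    have hc := fun (v : ℂ × ℂ) (j : Fin 2) => contDiff_covDeriv ξ v (contDiff_coord hs.1 j)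
    have hI : ∀ {g : ℂ × ℂ → ℂ} (c : ℂ), ContDiff ℝ ∞ g → ContDiff ℝ ∞ (fun q => c * g q) :=
      fun c hg => contDiff_const.mul hg
    fin_cases i
    · exact (hI 2 (((hc _ 0).sub (hI _ (hc _ 0))).div_const 2)).add
        (hI 2 (((hc _ 1).sub (hI _ (hc _ 1))).div_const 2))
    · exact (hI 2 (((hc _ 1).add (hI _ (hc _ 1))).div_const 2)).sub
        (hI 2 (((hc _ 0).add (hI _ (hc _ 0))).div_const 2))
  · refine hs.2.mono' fun p hp => ?_
    by_contra hn
    apply hp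
    have hz := fun (v : ℂ × ℂ) (j : Fin 2) =>
      covDeriv_eq_zero ξ v (fun q => s q j) p (fun h => hn (tsupport_coord s j h))
    ext i
    fin_cases i <;> simp [diracFun, nablaZ, nablaZbar, nablaW, nablaWbar, hz]

lemma differentiableAt_line {f : Space Ω → ℂ} (hf : ContDiff ℝ ∞ (lift f)) (v : ℂ × ℂ)
    (p : Space Ω) :
    DifferentiableAt ℝ (fun t : ℝ => f (p + (((t • v.1 : ℂ) : Torus Ω), t • v.2))) 0 := by
  obtain ⟨⟨z⟩, w⟩ := p
  have : (fun t : ℝ => f (((QuotientAddGroup.mk z : Torus Ω), w) +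
      (((t • v.1 : ℂ) : Torus Ω), t • v.2))) = fun t : ℝ => lift f ((z, w) + t • v) := rfl
  refine DifferentiableAt.congr_of_eventuallyEq (f := fun t : ℝ => lift f ((z, w) + t • v)) ?_
    (Filter.Eventually.of_forall fun t => congrFun this t)
  have hd : Differentiable ℝ (lift f) := hf.differentiable (by simp)
  fun_prop

lemma covDeriv_add (ξ : ℂ →L[ℝ] ℝ) (v : ℂ × ℂ) {f g : Space Ω → ℂ}
    (hf : ContDiff ℝ ∞ (lift f)) (hg : ContDiff ℝ ∞ (lift g)) (p : Space Ω) :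
    covDeriv ξ v (fun q => f q + g q) p = covDeriv ξ v f p + covDeriv ξ v g p := by
  have : dirDeriv v (fun q => f q + g q) p = dirDeriv v f p + dirDeriv v g p :=
    deriv_fun_add (differentiableAt_line hf v p) (differentiableAt_line hg v p)
  rw [covDeriv, this, covDeriv, covDeriv]
  ring

lemma covDeriv_smul (ξ : ℂ →L[ℝ] ℝ) (v : ℂ × ℂ) (c : ℂ) {f : Space Ω → ℂ}
    (hf : ContDiff ℝ ∞ (lift f)) (p : Space Ω) :
    covDeriv ξ v (fun q => c * f q) p = c * covDeriv ξ v f p := by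
  have : dirDeriv v (fun q => c * f q) p = c * dirDeriv v f p :=
    deriv_const_mul c (differentiableAt_line hf v p)
  rw [covDeriv, this, covDeriv]
  ring

/-- The Dirac operator `D*_ξ : Γ(L_ξ ⊗ S⁻) → Γ(L_ξ ⊗ S⁺)` on compactly supported smooth
sections. -/
def diracSmooth (ξ : ℂ →L[ℝ] ℝ) : Sections Ω →ₗ[ℂ] Sections Ω where
  toFun s := ⟨diracFun ξ s, diracFun_mem ξ s.2⟩
  map_add' := by
    intro s t
    ext p i
    have h := fun (v : ℂ × ℂ) (j : Fin 2) =>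
      covDeriv_add ξ v (contDiff_coord s.2.1 j) (contDiff_coord t.2.1 j) p
    fin_cases i <;>
      simp [diracFun, nablaZ, nablaZbar, nablaW, nablaWbar, h] <;> ring
  map_smul' := by
    intro c s
    ext p i
    have h := fun (v : ℂ × ℂ) (j : Fin 2) => covDeriv_smul ξ v c (contDiff_coord s.2.1 j) p
    fin_cases i <;>
      simp [diracFun, nablaZ, nablaZbar, nablaW, nablaWbar, h] <;> ring

/-! ### The Hilbert spaces -/

instance : IsFiniteMeasure (volume : Measure (Torus Ω)) := by
  have : IsFiniteMeasure ((volume : Measure ℂ).restrict (ZSpan.fundamentalDomain Ω)) :=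
    ⟨by simpa using (ZSpan.fundamentalDomain_isBounded Ω).measure_lt_top⟩
  exact Measure.isFiniteMeasure_map _ _

instance : IsClosed ((lattice Ω : AddSubgroup ℂ) : Set ℂ) :=
  AddSubgroup.isClosed_of_discrete

instance : (volume : Measure (Torus Ω)).IsOpenPosMeasure := by
  refine ⟨fun U hU hne h0 => ?_⟩
  have hpre : IsOpen ((QuotientAddGroup.mk : ℂ → Torus Ω) ⁻¹' U) :=
    hU.preimage QuotientAddGroup.continuous_mk
  obtain ⟨x, hx⟩ := hne
  obtain ⟨z, rfl⟩ := QuotientAddGroup.mk_surjective x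
  have hpos := hpre.measure_pos volume ⟨z, hx⟩
  have hfd := ZSpan.isAddFundamentalDomain' Ω (volume : Measure ℂ)
  have : Countable (lattice Ω) :=
    inferInstanceAs (Countable (Submodule.span ℤ (Set.range Ω)))
  have hv : ∀ (g : lattice Ω) (a : ℂ), ((g +ᵥ a : ℂ) : Torus Ω) = a := by
    intro g a
    rw [AddSubgroup.vadd_def, QuotientAddGroup.eq, vadd_eq_add]
    simp
  have hm : Measurable (QuotientAddGroup.mk : ℂ → Torus Ω) :=
    QuotientAddGroup.continuous_mk.measurable
  rw [show (volume : Measure (Torus Ω)) =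
    (volume.restrict (ZSpan.fundamentalDomain Ω)).map QuotientAddGroup.mk from rfl,
    Measure.map_apply hm hU.measurableSet, Measure.restrict_apply hpre.measurableSet] at h0
  refine hpos.ne' (hfd.measure_zero_of_invariant _ (fun g => ?_) h0)
  ext y
  constructor
  · rintro ⟨a, ha, rfl⟩
    change ((g +ᵥ a : ℂ) : Torus Ω) ∈ U
    rw [hv]
    exact ha
  · intro hy
    refine ⟨-g +ᵥ y, ?_, by simp⟩
    change ((-g +ᵥ y : ℂ) : Torus Ω) ∈ U
    rw [hv]
    exact hy

variable (Ω) in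
/-- The Hilbert space `L²` of sections over `T × ℂ` of `L_ξ ⊗ S⁺` or of `L_ξ ⊗ S⁻` (in the
unitary frames above), for the flat product metric. -/
abbrev L2 : Type := Lp Spinor 2 (volume : Measure (Space Ω))

lemma continuous_section (s : Sections Ω) : Continuous (s : Space Ω → Spinor) :=
  continuous_of_lift s.2.1.continuous

lemma memLp_section (s : Sections Ω) :
    MemLp (s : Space Ω → Spinor) 2 (volume : Measure (Space Ω)) :=
  (continuous_section s).memLp_of_hasCompactSupport s.2.2

/-- A compactly supported smooth section as an element of `L²`. -/
def toL2 : Sections Ω →ₗ[ℂ] L2 Ω where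
  toFun s := (memLp_section s).toLp s
  map_add' s t := MemLp.toLp_add (memLp_section s) (memLp_section t)
  map_smul' c s := MemLp.toLp_const_smul c (memLp_section s)

lemma toL2_injective : Function.Injective (toL2 (Ω := Ω)) := by
  intro s t h
  have h' := (MemLp.toLp_eq_toLp_iff (memLp_section s) (memLp_section t)).1 h
  exact Subtype.ext (Continuous.ae_eq_iff_eq _ (continuous_section s) (continuous_section t) |>.1 h')

/-- The space `Γ(L_ξ ⊗ S⁻)`, to be normed by `‖s‖_{L²} + ‖D*_ξ s‖_{L²}`. -/
def PreL21 (Ω : Module.Basis (Fin 2) ℝ ℂ) (_ξ : ℂ →L[ℝ] ℝ) : Type := Sections Ω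

variable (ξ : ℂ →L[ℝ] ℝ)

instance : AddCommGroup (PreL21 Ω ξ) := inferInstanceAs (AddCommGroup (Sections Ω))

instance : Module ℂ (PreL21 Ω ξ) := inferInstanceAs (Module ℂ (Sections Ω))

/-- The linear map `s ↦ (s, D*_ξ s)` into the direct sum `L² ⊕ L²` with norm
`‖(a, b)‖ = ‖a‖ + ‖b‖`. -/
def graphMap : PreL21 Ω ξ →ₗ[ℂ] WithLp 1 (L2 Ω × L2 Ω) :=
  (WithLp.linearEquiv 1 ℂ (L2 Ω × L2 Ω)).symm.toLinearMap ∘ₗ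
    (LinearMap.prod toL2 (toL2 ∘ₗ diracSmooth ξ) : Sections Ω →ₗ[ℂ] L2 Ω × L2 Ω)

lemma graphMap_injective : Function.Injective (graphMap (Ω := Ω) ξ) := by
  intro s t h
  have h1 : (graphMap (Ω := Ω) ξ s).fst = (graphMap (Ω := Ω) ξ t).fst := by rw [h]
  exact toL2_injective h1

/-- The norm `‖s‖_{L²₁} = ‖s‖_{L²} + ‖D*_ξ s‖_{L²}` on `Γ(L_ξ ⊗ S⁻)`. -/
instance : NormedAddCommGroup (PreL21 Ω ξ) :=
  NormedAddCommGroup.induced _ _ (graphMap ξ) (graphMap_injective ξ)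

instance : NormedSpace ℂ (PreL21 Ω ξ) :=
  NormedSpace.induced ℂ _ _ (graphMap ξ)

/-- The norm of `PreL21 Ω ξ` is `‖s‖_{L²} + ‖D*_ξ s‖_{L²}`. -/
lemma norm_preL21 (s : PreL21 Ω ξ) :
    ‖s‖ = ‖toL2 (show Sections Ω from s)‖ + ‖toL2 (diracSmooth ξ (show Sections Ω from s))‖ := by
  change ‖graphMap ξ s‖ = _
  rw [WithLp.prod_norm_eq_of_L1]
  rfl

/-- `D*_ξ` as a bounded operator on `Γ(L_ξ ⊗ S⁻)` with the `L²₁` norm. -/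
def diracPre : PreL21 Ω ξ →L[ℂ] L2 Ω :=
  LinearMap.mkContinuous
    (toL2 ∘ₗ diracSmooth ξ : Sections Ω →ₗ[ℂ] L2 Ω) 1 (by
      intro s
      rw [one_mul]
      have h := norm_preL21 ξ s
      have h0 := norm_nonneg (toL2 (show Sections Ω from s))
      refine le_trans ?_ (le_of_eq h.symm)
      exact le_add_of_nonneg_left h0)

variable (Ω) in
/-- The space `L²₁(L_ξ ⊗ S⁻)`: the completion of `Γ(L_ξ ⊗ S⁻)` with respect to
`‖s‖_{L²} + ‖D*_ξ s‖_{L²}`. -/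
abbrev L21 : Type := Completion (PreL21 Ω ξ)

variable (Ω) in
/-- The coupled Dirac operator `D*_ξ : L²₁(L_ξ ⊗ S⁻) → L²(L_ξ ⊗ S⁺)`, the continuous extension of
`D*_ξ` from smooth sections. -/
def dirac : L21 Ω ξ →L[ℂ] L2 Ω :=
  (diracPre ξ).extend (Completion.toComplL : PreL21 Ω ξ →L[ℂ] L21 Ω ξ)

/-- On smooth sections, the extended operator is the differential operator. -/
lemma dirac_coe (s : PreL21 Ω ξ) :
    dirac Ω ξ (s : L21 Ω ξ) = toL2 (diracSmooth ξ (show Sections Ω from s)) :=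
  ContinuousLinearMap.extend_eq _ (Completion.denseRange_coe)
    (Completion.isUniformInducing_coe _) s

end

end FlatModel

namespace FlatModel

noncomputable section

open MeasureTheory UniformSpace
open scoped ContDiff

variable {Ω : Module.Basis (Fin 2) ℝ ℂ}

/-! ### Translations of `T × ℂ` -/

/-! The operator is bounded below and has dense range. The first property makes it injective with
closed range, so the two together give a bijection of Banach spaces, with bounded inverse.

Lower bound. The connection is flat with constant coefficients, so its covariant derivatives
commute, and they are skew-adjoint. Expanding `‖D*_ξ s‖²` for a compactly supported `s`, all mixed
terms cancel and there remains the sum of the `‖∇_i s‖²` over the four coordinate directions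
(`weitzenboeck`). As `ξ` is not in the dual lattice, some period `l` has holonomy `exp(-iξ(l)) ≠ 1`.
Integrating the parallel-transported section around the closed loop in direction `l` recovers
`(exp(-iξ(l)) - 1) f(p)` from `∇_l f`, which is a Poincaré inequality (`exists_poincare`). Hence
`‖s‖ ≤ C ‖D*_ξ s‖` (`exists_dirac_estimate`), and this extends to the completion.

Dense range. An `f ∈ L²` orthogonal to the range is a weak solution of the adjoint equation.
Convolution with a smooth kernel commutes with the constant-coefficient operator, so it makes `f` a
smooth solution that is still in `L²` (`mollify_weak_solution`, `memLp_mollify`). After the two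
components are swapped, the adjoint system is the Dirac system with `i` replaced by `-i` in the
plane directions, and it obeys the same estimate. Cutting off by `χ(w/R)` costs an error of order
`1/R`, so a smooth `L²` solution vanishes (`eq_zero_of_adjoint`). All mollifications of `f` are
therefore zero, and so is `f`. -/

instance : Countable (lattice Ω) :=
  inferInstanceAs (Countable (Submodule.span ℤ (Set.range Ω)))

instance : Countable (lattice Ω).op :=
  (AddSubgroup.equivOp (lattice Ω)).symm.injective.countable

/-- The quotient-measure theory acts through the opposite subgroup, by right translations;
commutativity of `ℂ` transfers the usual fundamental domain. It yields translation invariance of the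
area measure. -/
lemma isAddFundamentalDomain_op :
    IsAddFundamentalDomain (lattice Ω).op (ZSpan.fundamentalDomain Ω) (volume : Measure ℂ) := by
  refine IsAddFundamentalDomain.mk' (ZSpan.fundamentalDomain_measurableSet Ω).nullMeasurableSet
    fun x => ?_
  obtain ⟨v, hv, huniq⟩ := ZSpan.exist_unique_vadd_mem_fundamentalDomain Ω x
  have e : ∀ g : (lattice Ω).op, g +ᵥ x =
      (⟨g.1.unop, g.2⟩ : Submodule.span ℤ (Set.range Ω)) +ᵥ x := fun g => add_comm _ _
  refine ⟨⟨AddOpposite.op v.1, v.2⟩, ?_, fun g hg => ?_⟩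
  · exact (congrArg (· ∈ ZSpan.fundamentalDomain Ω) (e ⟨AddOpposite.op v.1, v.2⟩)).mpr hv
  · have := huniq ⟨g.1.unop, g.2⟩ (show _ ∈ _ from e g ▸ (show g +ᵥ x ∈ _ from hg))
    exact Subtype.ext (AddOpposite.unop_injective (congrArg Subtype.val this))

instance : AddQuotientMeasureEqMeasurePreimage (volume : Measure ℂ)
    (volume : Measure (Torus Ω)) :=
  isAddFundamentalDomain_op.addQuotientMeasureEqMeasurePreimage rfl

instance : HasAddFundamentalDomain (lattice Ω).op ℂ (volume : Measure ℂ) :=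
  ⟨⟨_, isAddFundamentalDomain_op⟩⟩

instance : (volume : Measure (Torus Ω)).IsAddLeftInvariant :=
  MeasureTheory.AddQuotientMeasureEqMeasurePreimage.addInvariantMeasure_quotient
    (volume : Measure ℂ)

instance : (volume : Measure (Space Ω)).IsAddLeftInvariant :=
  Measure.prod.instIsAddLeftInvariant

instance : (volume : Measure (ℂ × ℂ)).IsAddHaarMeasure := Measure.prod.instIsAddHaarMeasure _ _

/-- The covering map `ℂ × ℂ → T × ℂ`. -/
def proj : ℂ × ℂ →+ Space Ω where
  toFun q := ((q.1 : Torus Ω), q.2)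
  map_zero' := rfl
  map_add' _ _ := rfl

lemma lift_apply {F : Type*} (f : Space Ω → F) (q : ℂ × ℂ) : lift f q = f (proj q) := rfl

lemma continuous_proj : Continuous (proj : ℂ × ℂ → Space Ω) :=
  (QuotientAddGroup.continuous_mk.comp continuous_fst).prodMk continuous_snd

lemma proj_surjective : Function.Surjective (proj : ℂ × ℂ → Space Ω) := by
  rintro ⟨⟨z⟩, w⟩
  exact ⟨(z, w), rfl⟩

lemma compactSpace_torus : CompactSpace (Torus Ω) := by
  refine ⟨?_⟩
  have hc : IsCompact (closure (ZSpan.fundamentalDomain Ω)) :=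
    (ZSpan.fundamentalDomain_isBounded Ω).isCompact_closure
  convert hc.image (QuotientAddGroup.continuous_mk (N := lattice Ω))
  refine (Set.eq_univ_of_forall fun x => ?_).symm
  obtain ⟨z, rfl⟩ := QuotientAddGroup.mk_surjective x
  refine ⟨ZSpan.fract Ω z, subset_closure (ZSpan.fract_mem_fundamentalDomain Ω z), ?_⟩
  rw [QuotientAddGroup.eq, ZSpan.fract]
  simp

section Flow

variable {E : Type*} [NormedAddCommGroup E] {h : Space Ω → E}

lemma integrable_flow (hc : Continuous h) (hs : HasCompactSupport h) (v : ℂ × ℂ) :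
    Integrable (Function.uncurry fun (p : Space Ω) (t : ℝ) => h (p + proj (t • v)))
      ((volume : Measure (Space Ω)).prod (volume.restrict (Set.Ioc (0 : ℝ) 1))) := by
  have hF : Continuous (Function.uncurry fun (p : Space Ω) (t : ℝ) => h (p + proj (t • v))) :=
    hc.comp (continuous_fst.add (continuous_proj.comp (continuous_snd.smul continuous_const)))
  have hi : Integrable h := hc.integrable_of_hasCompactSupport hs
  rw [integrable_prod_iff' hF.aestronglyMeasurable]
  refine ⟨Filter.Eventually.of_forall fun t => hi.comp_add_right (proj (t • v)), ?_⟩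
  simp only [Function.uncurry_apply_pair]
  have : (fun t : ℝ => ∫ p : Space Ω, ‖h (p + proj (t • v))‖) = fun _ => ∫ p, ‖h p‖ := by
    funext t
    exact integral_add_right_eq_self (fun p => ‖h p‖) _
  rw [this]
  exact integrable_const _

/-- By Fubini and translation invariance, averaging along a unit-time flow preserves the integral.
This turns identities along single flow lines into global ones. -/
lemma integral_flow [NormedSpace ℝ E] [CompleteSpace E] (hc : Continuous h)
    (hs : HasCompactSupport h) (v : ℂ × ℂ) :
    ∫ p, ∫ t in (0 : ℝ)..1, h (p + proj (t • v)) = ∫ p, h p := by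
  simp_rw [intervalIntegral.integral_of_le zero_le_one]
  rw [integral_integral_swap (integrable_flow hc hs v)]
  have : (fun t : ℝ => ∫ p : Space Ω, h (p + proj (t • v))) = fun _ => ∫ p, h p :=
    funext fun t => integral_add_right_eq_self h _
  rw [this]
  simp

end Flow

/-! ### Local integrability of lifts -/

lemma measurePreserving_proj :
    MeasurePreserving (proj : ℂ × ℂ → Space Ω)
      ((volume.restrict (ZSpan.fundamentalDomain Ω)).prod volume) volume :=
  MeasurePreserving.prod
    (⟨QuotientAddGroup.continuous_mk.measurable, rfl⟩ :
      MeasurePreserving (QuotientAddGroup.mk : ℂ → Torus Ω)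
        (volume.restrict (ZSpan.fundamentalDomain Ω)) volume)
    (MeasurePreserving.id (volume : Measure ℂ))

lemma exists_isOpen_subset_fundamentalDomain :
    ∃ U : Set ℂ, IsOpen U ∧ U.Nonempty ∧ U ⊆ ZSpan.fundamentalDomain Ω := by
  refine ⟨⋂ i, (fun z => Ω.repr z i) ⁻¹' Set.Ioo 0 1, ?_, ?_, ?_⟩
  · refine isOpen_iInter_of_finite fun i => isOpen_Ioo.preimage ?_
    exact (LinearMap.continuous_of_finiteDimensional (Ω.coord i))
  · refine ⟨∑ i, (1 / 2 : ℝ) • Ω i, Set.mem_iInter.2 fun i => ?_⟩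
    simp only [Set.mem_preimage, Module.Basis.repr_sum_self]
    norm_num
  · intro z hz i
    exact Set.Ioo_subset_Ico_self (Set.mem_iInter.1 hz i)

lemma memLp_comp_add {f : Space Ω → ℂ} (hf : MemLp f 2) (c : Space Ω) :
    MemLp (fun p => f (p + c)) 2 :=
  hf.comp_measurePreserving (measurePreserving_add_right volume c)

/-- On a bounded patch inside a fundamental domain the lift is `L²`, hence `L¹`; translations carry
a neighbourhood of any point into that patch. -/
lemma locallyIntegrable_lift {f : Space Ω → ℂ} (hf : MemLp f 2) :
    LocallyIntegrable (lift f) := by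
  obtain ⟨U, hU, ⟨u, hu⟩, hUF⟩ := exists_isOpen_subset_fundamentalDomain (Ω := Ω)
  have key : ∀ g : Space Ω → ℂ, MemLp g 2 →
      IntegrableOn (lift g) (U ×ˢ Metric.ball (0 : ℂ) 1) := by
    intro g hg
    have h1 : MemLp (lift g) 2 (volume.restrict (U ×ˢ Metric.ball (0 : ℂ) 1)) := by
      refine (hg.comp_measurePreserving measurePreserving_proj).mono_measure ?_
      rw [Measure.volume_eq_prod, ← Measure.prod_restrict]
      exact Measure.prod_mono (Measure.restrict_mono hUF le_rfl) Measure.restrict_le_self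
    have : IsFiniteMeasure
        ((volume : Measure (ℂ × ℂ)).restrict (U ×ˢ Metric.ball (0 : ℂ) 1)) := by
      refine ⟨?_⟩
      rw [Measure.restrict_apply_univ]
      exact (((ZSpan.fundamentalDomain_isBounded Ω).subset hUF).prod
        Metric.isBounded_ball).measure_lt_top
    exact h1.integrable (by norm_num)
  intro q
  -- Subtracting `c` moves `q` to the point `(u, 0)` of the patch.
  set c : ℂ × ℂ := q - (u, 0)
  refine ⟨(fun x => x - c) ⁻¹' (U ×ˢ Metric.ball (0 : ℂ) 1), ?_, ?_⟩
  · refine ((hU.prod Metric.isOpen_ball).preimage (continuous_id.sub continuous_const)).mem_nhds ?_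
    simp [hu]
  · have h := key _ (memLp_comp_add hf (proj c))
    have hmp : MeasurePreserving (fun x : ℂ × ℂ => x - c) volume volume :=
      measurePreserving_sub_right volume c
    have h2 := (hmp.integrableOn_comp_preimage
      (Homeomorph.subRight c).measurableEmbedding).2 h
    refine h2.congr_fun_ae (Filter.Eventually.of_forall fun x => ?_)
    simp [lift_apply]

/-! ### Calculus of smooth functions on `T × ℂ` -/

/-- Smooth functions on `T × ℂ`. -/
def Smooth (f : Space Ω → ℂ) : Prop := ContDiff ℝ ∞ (lift f)

/-- Compactly supported smooth functions on `T × ℂ`. -/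
structure TestFunction (f : Space Ω → ℂ) : Prop where
  smooth : Smooth f
  hasCompactSupport : HasCompactSupport f

namespace Smooth

variable {f g : Space Ω → ℂ}

lemma continuous (hf : Smooth f) : Continuous f :=
  continuous_of_lift (ContDiff.continuous hf)

lemma add (hf : Smooth f) (hg : Smooth g) : Smooth (fun p => f p + g p) :=
  ContDiff.add hf hg

lemma mul (hf : Smooth f) (hg : Smooth g) : Smooth (fun p => f p * g p) :=
  ContDiff.mul (𝕜 := ℝ) hf hg

lemma const_mul (c : ℂ) (hf : Smooth f) : Smooth (fun p => c * f p) :=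
  ContDiff.mul (𝕜 := ℝ) contDiff_const hf

lemma conj (hf : Smooth f) : Smooth (fun p => starRingEnd ℂ (f p)) :=
  Complex.conjCLE.contDiff.comp hf

lemma dirDeriv (v : ℂ × ℂ) (hf : Smooth f) : Smooth (dirDeriv v f) :=
  contDiff_dirDeriv v hf

lemma covDeriv (ξ : ℂ →L[ℝ] ℝ) (v : ℂ × ℂ) (hf : Smooth f) : Smooth (covDeriv ξ v f) :=
  contDiff_covDeriv ξ v hf

lemma hasDerivAt_line (hf : Smooth f) (v : ℂ × ℂ) (p : Space Ω) (t : ℝ) :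
    HasDerivAt (fun t : ℝ => f (p + proj (t • v)))
      (FlatModel.dirDeriv v f (p + proj (t • v))) t := by
  have h0 : HasDerivAt (fun r : ℝ => f (p + proj (t • v) + proj (r • v)))
      (FlatModel.dirDeriv v f (p + proj (t • v))) (t + -t) := by
    rw [add_neg_cancel]
    exact (differentiableAt_line hf v _).hasDerivAt
  refine (h0.comp_add_const t (-t)).congr_of_eventuallyEq (Filter.Eventually.of_forall fun r => ?_)
  simp only [add_assoc, ← map_add, ← add_smul]
  congr 3
  ring_nf

end Smooth

lemma hasDerivAt_dirDeriv {f : Space Ω → ℂ} (hf : Smooth f) (v : ℂ × ℂ) (p : Space Ω) :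
    HasDerivAt (fun t : ℝ => f (p + proj (t • v))) (dirDeriv v f p) 0 := by
  simpa using hf.hasDerivAt_line v p 0

lemma dirDeriv_mul {f g : Space Ω → ℂ} (hf : Smooth f) (hg : Smooth g) (v : ℂ × ℂ)
    (p : Space Ω) :
    dirDeriv v (fun q => f q * g q) p = dirDeriv v f p * g p + f p * dirDeriv v g p := by
  have h := ((hasDerivAt_dirDeriv hf v p).mul (hasDerivAt_dirDeriv hg v p)).deriv
  simp only [zero_smul, map_zero, add_zero] at h
  exact h

lemma dirDeriv_conj {f : Space Ω → ℂ} (hf : Smooth f) (v : ℂ × ℂ) (p : Space Ω) :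
    dirDeriv v (fun q => starRingEnd ℂ (f q)) p = starRingEnd ℂ (dirDeriv v f p) :=
  (Complex.conjCLE.hasFDerivAt.comp_hasDerivAt _ (hasDerivAt_dirDeriv hf v p)).deriv

lemma dirDeriv_eq_fderiv {f : Space Ω → ℂ} (hf : Smooth f) (v q : ℂ × ℂ) :
    lift (dirDeriv v f) q = fderiv ℝ (lift f) q v := by
  rw [dirDeriv_lift]
  exact (ContDiff.differentiable hf (by simp) q).lineDeriv_eq_fderiv

lemma dirDeriv_comm {f : Space Ω → ℂ} (hf : Smooth f) (v w : ℂ × ℂ) (p : Space Ω) :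
    dirDeriv v (dirDeriv w f) p = dirDeriv w (dirDeriv v f) p := by
  obtain ⟨q, rfl⟩ := proj_surjective p
  have hd : DifferentiableAt ℝ (fderiv ℝ (lift f)) q :=
    (ContDiff.fderiv_right (m := ∞) hf (by simp)).differentiable (by simp) q
  have key : ∀ v w : ℂ × ℂ, dirDeriv v (dirDeriv w f) (proj q) =
      fderiv ℝ (fderiv ℝ (lift f)) q v w := by
    intro v w
    rw [← lift_apply (dirDeriv v (dirDeriv w f)), dirDeriv_eq_fderiv (hf.dirDeriv w),
      show lift (dirDeriv w f) = fun q => fderiv ℝ (lift f) q w from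
        funext (dirDeriv_eq_fderiv hf w)]
    rw [fderiv_clm_apply hd (differentiableAt_const w)]
    simp
  rw [key, key]
  exact (ContDiff.contDiffAt hf).isSymmSndFDerivAt
    (by simpa using WithTop.coe_le_coe.2 (le_top : (2 : ℕ∞) ≤ ⊤)) v w

lemma dirDeriv_sub {f g : Space Ω → ℂ} (hf : Smooth f) (hg : Smooth g) (v : ℂ × ℂ)
    (p : Space Ω) :
    dirDeriv v (fun q => f q - g q) p = dirDeriv v f p - dirDeriv v g p :=
  ((hasDerivAt_dirDeriv hf v p).sub (hasDerivAt_dirDeriv hg v p)).deriv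

lemma dirDeriv_const_mul (c : ℂ) {f : Space Ω → ℂ} (hf : Smooth f) (v : ℂ × ℂ) (p : Space Ω) :
    dirDeriv v (fun q => c * f q) p = c * dirDeriv v f p :=
  ((hasDerivAt_dirDeriv hf v p).const_mul c).deriv

/-- Flatness: the connection form is constant, so only the symmetry of second derivatives is needed.
-/
lemma covDeriv_comm (ξ : ℂ →L[ℝ] ℝ) {f : Space Ω → ℂ} (hf : Smooth f) (v w : ℂ × ℂ)
    (p : Space Ω) :
    covDeriv ξ v (covDeriv ξ w f) p = covDeriv ξ w (covDeriv ξ v f) p := by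
  have key : ∀ v w : ℂ × ℂ, covDeriv ξ v (covDeriv ξ w f) p =
      dirDeriv v (dirDeriv w f) p - Complex.I * (ξ w.1 : ℂ) * dirDeriv v f p -
        Complex.I * (ξ v.1 : ℂ) * (dirDeriv w f p - Complex.I * (ξ w.1 : ℂ) * f p) := by
    intro v w
    have h := dirDeriv_sub (hf.dirDeriv w) (hf.const_mul (Complex.I * (ξ w.1 : ℂ))) v p
    rw [dirDeriv_const_mul _ hf] at h
    rw [covDeriv, ← h]
    rfl
  rw [key, key, dirDeriv_comm hf v w]
  ring

lemma covDeriv_mul (ξ : ℂ →L[ℝ] ℝ) {f g : Space Ω → ℂ} (hf : Smooth f) (hg : Smooth g)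
    (v : ℂ × ℂ) (p : Space Ω) :
    covDeriv ξ v (fun q => f q * g q) p = dirDeriv v f p * g p + f p * covDeriv ξ v g p := by
  rw [covDeriv, dirDeriv_mul hf hg, covDeriv]
  ring

lemma dirDeriv_add_smul {f : Space Ω → ℂ} (hf : Smooth f) (a b : ℝ) (v w : ℂ × ℂ)
    (p : Space Ω) :
    dirDeriv (a • v + b • w) f p = a * dirDeriv v f p + b * dirDeriv w f p := by
  obtain ⟨q, rfl⟩ := proj_surjective p
  simp only [← lift_apply, dirDeriv_eq_fderiv hf, map_add, map_smul, Complex.real_smul]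

lemma covDeriv_add_smul (ξ : ℂ →L[ℝ] ℝ) {f : Space Ω → ℂ} (hf : Smooth f) (a b : ℝ)
    (v w : ℂ × ℂ) (p : Space Ω) :
    covDeriv ξ (a • v + b • w) f p = a * covDeriv ξ v f p + b * covDeriv ξ w f p := by
  simp only [covDeriv, dirDeriv_add_smul hf, Prod.fst_add, Prod.smul_fst, map_add, map_smul,
    smul_eq_mul]
  push_cast
  ring

lemma dirDeriv_translate (v : ℂ × ℂ) (f : Space Ω → ℂ) (c p : Space Ω) :
    dirDeriv v (fun q => f (q + c)) p = dirDeriv v f (p + c) := by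
  simp only [dirDeriv]
  congr 1
  funext t
  rw [add_right_comm]

lemma covDeriv_translate (ξ : ℂ →L[ℝ] ℝ) (v : ℂ × ℂ) (f : Space Ω → ℂ) (c p : Space Ω) :
    covDeriv ξ v (fun q => f (q + c)) p = covDeriv ξ v f (p + c) := by
  rw [covDeriv, dirDeriv_translate, covDeriv]

namespace TestFunction

variable {f g : Space Ω → ℂ}

lemma continuous (hf : TestFunction f) : Continuous f := hf.smooth.continuous

lemma add (hf : TestFunction f) (hg : TestFunction g) : TestFunction (fun p => f p + g p) :=
  ⟨hf.1.add hg.1, hf.2.add hg.2⟩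

lemma mul_left (hg : TestFunction g) (hf : Smooth f) : TestFunction (fun p => f p * g p) :=
  ⟨hf.mul hg.1, hg.2.mul_left⟩

lemma mul_right (hf : TestFunction f) (hg : Smooth g) : TestFunction (fun p => f p * g p) :=
  ⟨hf.1.mul hg, hf.2.mul_right⟩

lemma const_mul (c : ℂ) (hf : TestFunction f) : TestFunction (fun p => c * f p) :=
  ⟨hf.1.const_mul c, hf.2.mul_left (f := fun _ => c)⟩

lemma sub (hf : TestFunction f) (hg : TestFunction g) : TestFunction (fun p => f p - g p) := by
  simpa [sub_eq_add_neg] using hf.add (hg.const_mul (-1))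

lemma conj (hf : TestFunction f) : TestFunction (fun p => starRingEnd ℂ (f p)) :=
  ⟨hf.1.conj, hf.2.comp_left (map_zero _)⟩

lemma dirDeriv (v : ℂ × ℂ) (hf : TestFunction f) : TestFunction (dirDeriv v f) :=
  ⟨hf.1.dirDeriv v, hf.2.mono' fun p hp => by
    by_contra hn
    exact hp (dirDeriv_eq_zero v f p hn)⟩

lemma covDeriv (ξ : ℂ →L[ℝ] ℝ) (v : ℂ × ℂ) (hf : TestFunction f) :
    TestFunction (covDeriv ξ v f) :=
  ⟨hf.1.covDeriv ξ v, hf.2.mono' fun p hp => by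
    by_contra hn
    exact hp (covDeriv_eq_zero ξ v f p hn)⟩

lemma translate (hf : TestFunction f) (c : Space Ω) : TestFunction (fun p => f (p + c)) := by
  obtain ⟨c, rfl⟩ := proj_surjective c
  refine ⟨?_, hf.2.comp_homeomorph (Homeomorph.addRight (proj c))⟩
  exact ContDiff.comp (g := lift f) hf.1 (contDiff_id.add contDiff_const : ContDiff ℝ ∞ (· + c))

lemma integrable (hf : TestFunction f) : Integrable f :=
  hf.continuous.integrable_of_hasCompactSupport hf.2

lemma memLp (hf : TestFunction f) : MemLp f 2 :=
  hf.continuous.memLp_of_hasCompactSupport hf.2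

end TestFunction

/-- Averaging the derivative along the flow gives `f(p + v) - f(p)`, whose integral vanishes by
translation invariance. -/
lemma integral_dirDeriv {f : Space Ω → ℂ} (hf : TestFunction f) (v : ℂ × ℂ) :
    ∫ p, dirDeriv v f p = 0 := by
  have hd := hf.dirDeriv v
  rw [← integral_flow hd.continuous hd.2 v]
  have h : ∀ p : Space Ω, ∫ t in (0 : ℝ)..1, dirDeriv v f (p + proj (t • v)) =
      f (p + proj v) - f p := by
    intro p
    rw [intervalIntegral.integral_eq_sub_of_hasDerivAt
      (fun t _ => hf.smooth.hasDerivAt_line v p t)]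
    · simp
    · exact (hd.continuous.comp (continuous_const.add (continuous_proj.comp
        (continuous_id.smul continuous_const)))).intervalIntegrable _ _
  simp_rw [h]
  rw [integral_sub (hf.integrable.comp_add_right (proj v)) hf.integrable,
    integral_add_right_eq_self f, sub_self]

/-- Covariant derivatives are skew-adjoint. -/
lemma integral_covDeriv_mul_conj (ξ : ℂ →L[ℝ] ℝ) (v : ℂ × ℂ) {f g : Space Ω → ℂ}
    (hf : Smooth f) (hg : TestFunction g) :
    ∫ p, covDeriv ξ v f p * starRingEnd ℂ (g p) =
      -∫ p, f p * starRingEnd ℂ (covDeriv ξ v g p) := by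
  have h := integral_dirDeriv (hg.conj.mul_left hf) v
  rw [eq_neg_iff_add_eq_zero, ← h, ← integral_add]
  · congr 1
    funext p
    rw [dirDeriv_mul hf hg.1.conj, dirDeriv_conj hg.1, covDeriv, covDeriv]
    simp only [map_sub, map_mul, Complex.conj_I, Complex.conj_ofReal]
    ring
  · exact (hg.conj.mul_left (hf.covDeriv ξ v)).integrable
  · exact ((hg.covDeriv ξ v).conj.mul_left hf).integrable

/-- Integrate by parts, commute, integrate back. This is the symmetry that cancels the mixed terms
in the Weitzenböck identity. -/
lemma integral_covDeriv_mul_conj_covDeriv_comm (ξ : ℂ →L[ℝ] ℝ) (v w : ℂ × ℂ)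
    {f g : Space Ω → ℂ} (hf : TestFunction f) (hg : TestFunction g) :
    ∫ p, covDeriv ξ v f p * starRingEnd ℂ (covDeriv ξ w g p) =
      ∫ p, covDeriv ξ w f p * starRingEnd ℂ (covDeriv ξ v g p) := by
  rw [integral_covDeriv_mul_conj ξ v hf.1 (hg.covDeriv ξ w),
    integral_covDeriv_mul_conj ξ w hf.1 (hg.covDeriv ξ v)]
  simp_rw [covDeriv_comm ξ hg.1 v w]

/-! ### The Poincaré inequality for a nontrivial flat line bundle -/

lemma TestFunction.integrable_norm_sq {f : Space Ω → ℂ} (hf : TestFunction f) :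
    Integrable (fun p => ‖f p‖ ^ 2) :=
  hf.memLp.integrable_norm_pow (by norm_num)

/-- Integrate `(φ - m)² ≥ 0`, where `m` is the mean of `φ`. -/
lemma sq_integral_unitInterval_le {φ : ℝ → ℝ} (hφ : Continuous φ) :
    (∫ t in (0 : ℝ)..1, φ t) ^ 2 ≤ ∫ t in (0 : ℝ)..1, φ t ^ 2 := by
  set m := ∫ t in (0 : ℝ)..1, φ t
  have h : ∫ t in (0 : ℝ)..1, 2 * m * φ t ≤ ∫ t in (0 : ℝ)..1, (φ t ^ 2 + m ^ 2) :=
    intervalIntegral.integral_mono_on zero_le_one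
      ((continuous_const.mul hφ).intervalIntegrable _ _)
      (((hφ.pow 2).add continuous_const).intervalIntegrable _ _)
      fun t _ => by nlinarith [sq_nonneg (φ t - m)]
  have hadd : ∫ t in (0 : ℝ)..1, (φ t ^ 2 + m ^ 2) =
      (∫ t in (0 : ℝ)..1, φ t ^ 2) + ∫ t in (0 : ℝ)..1, m ^ 2 :=
    intervalIntegral.integral_add ((hφ.pow 2).intervalIntegrable _ _) intervalIntegrable_const
  rw [intervalIntegral.integral_const_mul, hadd] at h
  simp only [intervalIntegral.integral_const, sub_zero, one_smul] at h
  change 2 * m * m ≤ _ at h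
  nlinarith

lemma proj_lattice {l : ℂ} (hl : l ∈ lattice Ω) : (proj (l, 0) : Space Ω) = 0 :=
  Prod.ext ((QuotientAddGroup.eq_zero_iff l).2 hl) rfl

/-- The factor `exp(-iξ(l)t)` turns `∇_l` into `d/dt` along `t ↦ p + tl`. This line closes up at `t
= 1`, so the fundamental theorem of calculus gives `(exp(-iξ(l)) - 1) f(p)`; then apply
Cauchy–Schwarz. -/
lemma holonomy_norm_le (ξ : ℂ →L[ℝ] ℝ) {f : Space Ω → ℂ} (hf : Smooth f) {l : ℂ}
    (hl : l ∈ lattice Ω) (p : Space Ω) :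
    ‖Complex.exp (-(Complex.I * ξ l)) - 1‖ ^ 2 * ‖f p‖ ^ 2 ≤
      ∫ t in (0 : ℝ)..1, ‖covDeriv ξ (l, 0) f (p + proj (t • (l, 0)))‖ ^ 2 := by
  have hcov : Continuous fun t : ℝ => covDeriv ξ (l, 0) f (p + proj (t • (l, 0))) :=
    (hf.covDeriv ξ (l, 0)).continuous.comp (continuous_const.add
      (continuous_proj.comp (continuous_id.smul continuous_const)))
  have hexp : Continuous fun t : ℝ => Complex.exp (-(Complex.I * ξ l) * t) := by fun_prop
  have hd : ∀ t : ℝ, HasDerivAt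
      (fun t : ℝ => Complex.exp (-(Complex.I * ξ l) * t) * f (p + proj (t • (l, 0))))
      (Complex.exp (-(Complex.I * ξ l) * t) *
        covDeriv ξ (l, 0) f (p + proj (t • (l, 0)))) t := by
    intro t
    have h1 : HasDerivAt (fun t : ℝ => Complex.exp (-(Complex.I * ξ l) * t))
        (Complex.exp (-(Complex.I * ξ l) * t) * (-(Complex.I * ξ l) * 1)) t :=
      ((Complex.ofRealCLM.hasDerivAt (x := t)).const_mul _).cexp
    refine (h1.mul (hf.hasDerivAt_line (l, 0) p t)).congr_deriv ?_
    simp only [covDeriv]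
    ring
  have hint := intervalIntegral.integral_eq_sub_of_hasDerivAt (a := 0) (b := 1)
    (fun t _ => hd t) ((hexp.mul hcov).intervalIntegrable _ _)
  have hend : ∫ t in (0 : ℝ)..1, Complex.exp (-(Complex.I * ξ l) * t) *
        covDeriv ξ (l, 0) f (p + proj (t • (l, 0))) =
      (Complex.exp (-(Complex.I * ξ l)) - 1) * f p := by
    rw [hint]
    simp only [one_smul, proj_lattice hl, zero_smul, map_zero, add_zero, Complex.ofReal_one,
      Complex.ofReal_zero, mul_one, mul_zero, Complex.exp_zero]
    ring
  rw [← mul_pow, ← norm_mul, ← hend]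
  refine le_trans (pow_le_pow_left₀ (norm_nonneg _)
    (intervalIntegral.norm_integral_le_integral_norm zero_le_one) 2) ?_
  refine le_trans (le_of_eq ?_) (sq_integral_unitInterval_le hcov.norm)
  congr 2
  funext t
  rw [norm_mul, Complex.norm_exp]
  simp

lemma norm_covDeriv_sq_le (ξ : ℂ →L[ℝ] ℝ) {f : Space Ω → ℂ} (hf : Smooth f) (l : ℂ)
    (p : Space Ω) :
    ‖covDeriv ξ (l, 0) f p‖ ^ 2 ≤ ‖l‖ ^ 2 *
      (‖covDeriv ξ (1, 0) f p‖ ^ 2 + ‖covDeriv ξ (Complex.I, 0) f p‖ ^ 2) := by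
  have hl : (l, (0 : ℂ)) = l.re • ((1 : ℂ), (0 : ℂ)) + l.im • (Complex.I, (0 : ℂ)) := by
    ext <;> simp
  rw [hl, covDeriv_add_smul ξ hf]
  have h := norm_add_le ((l.re : ℂ) * covDeriv ξ (1, 0) f p)
    ((l.im : ℂ) * covDeriv ξ (Complex.I, 0) f p)
  rw [norm_mul, norm_mul, Complex.norm_real, Complex.norm_real, Real.norm_eq_abs,
    Real.norm_eq_abs] at h
  refine (pow_le_pow_left₀ (norm_nonneg _) h 2).trans ?_
  rw [Complex.sq_norm l, Complex.normSq_apply, ← abs_mul_abs_self l.re, ← abs_mul_abs_self l.im]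
  -- The square is the defect in Cauchy–Schwarz for two-dimensional vectors (Lagrange's identity).
  nlinarith [sq_nonneg (|l.re| * ‖covDeriv ξ (Complex.I, 0) f p‖ -
    |l.im| * ‖covDeriv ξ (1, 0) f p‖)]

lemma exists_poincare {ξ : ℂ →L[ℝ] ℝ} (hξ : ξ ∉ dualLattice Ω) :
    ∃ κ : ℝ, 0 < κ ∧ ∀ f : Space Ω → ℂ, TestFunction f →
      κ * ∫ p, ‖f p‖ ^ 2 ≤
        (∫ p, ‖covDeriv ξ (1, 0) f p‖ ^ 2) + ∫ p, ‖covDeriv ξ (Complex.I, 0) f p‖ ^ 2 := by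
  obtain ⟨l, hl, hn⟩ : ∃ l ∈ lattice Ω, ∀ n : ℤ, ξ l ≠ 2 * Real.pi * n := by
    by_contra! h
    exact hξ h
  have hl0 : l ≠ 0 := by
    rintro rfl
    exact hn 0 (by simp)
  have hexp : Complex.exp (-(Complex.I * ξ l)) - 1 ≠ 0 := by
    rw [sub_ne_zero, Ne, Complex.exp_eq_one_iff]
    rintro ⟨n, h⟩
    refine hn (-n) ?_
    have h1 := congrArg Complex.im h
    simp at h1
    push_cast
    linarith
  have hlpos : 0 < ‖l‖ ^ 2 := by positivity
  refine ⟨‖Complex.exp (-(Complex.I * ξ l)) - 1‖ ^ 2 / ‖l‖ ^ 2,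
    div_pos (pow_pos (norm_pos_iff.2 hexp) 2) hlpos, fun f hf => ?_⟩
  have hc := hf.covDeriv ξ (l, 0)
  have hcs : HasCompactSupport fun p => ‖covDeriv ξ (l, 0) f p‖ ^ 2 :=
    hc.2.comp_left (g := fun z : ℂ => ‖z‖ ^ 2) (by simp)
  have hcc : Continuous fun p => ‖covDeriv ξ (l, 0) f p‖ ^ 2 := hc.continuous.norm.pow 2
  have h1 : ‖Complex.exp (-(Complex.I * ξ l)) - 1‖ ^ 2 * ∫ p, ‖f p‖ ^ 2 ≤
      ∫ p, ‖covDeriv ξ (l, 0) f p‖ ^ 2 := by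
    rw [← integral_flow hcc hcs (l, 0), ← integral_const_mul]
    refine integral_mono (hf.integrable_norm_sq.const_mul _) ?_ fun p =>
      holonomy_norm_le ξ hf.1 hl p
    simp_rw [intervalIntegral.integral_of_le zero_le_one]
    exact (integrable_flow hcc hcs (l, 0)).integral_prod_left
  have h2 : ∫ p, ‖covDeriv ξ (l, 0) f p‖ ^ 2 ≤ ‖l‖ ^ 2 *
      ((∫ p, ‖covDeriv ξ (1, 0) f p‖ ^ 2) + ∫ p, ‖covDeriv ξ (Complex.I, 0) f p‖ ^ 2) := by
    rw [← integral_add (hf.covDeriv ξ _).integrable_norm_sq (hf.covDeriv ξ _).integrable_norm_sq,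
      ← integral_const_mul]
    exact integral_mono hc.integrable_norm_sq (((hf.covDeriv ξ _).integrable_norm_sq.add
      (hf.covDeriv ξ _).integrable_norm_sq).const_mul _) fun p => norm_covDeriv_sq_le ξ hf.1 l p
  rw [div_mul_eq_mul_div, div_le_iff₀ hlpos]
  linarith

/-! ### The Weitzenböck identity -/

/-- Here `x i` and `y i` stand for the derivatives `∇_i a` and `∇_i b`. The symmetries cancel the
cross terms in pairs. The number `c = ±i` is left free so that the Dirac operator (`c = -i`) and its
adjoint (`c = i`) are treated at once. -/
lemma weitzenboeck_inner {E : Type*} [NormedAddCommGroup E] [InnerProductSpace ℂ E]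
    (x y : Fin 4 → E)
    (hx : ∀ i j, inner ℂ (x i) (x j) = inner ℂ (x j) (x i))
    (hy : ∀ i j, inner ℂ (y i) (y j) = inner ℂ (y j) (y i))
    (hxy : ∀ i j, inner ℂ (x i) (y j) = inner ℂ (x j) (y i)) {c : ℂ}
    (hc : starRingEnd ℂ c = -c) (hc2 : c * c = -1) :
    ‖x 0 + -Complex.I • x 1 + (y 2 + c • y 3)‖ ^ 2 +
      ‖y 0 + Complex.I • y 1 - (x 2 + -c • x 3)‖ ^ 2 =
      ∑ i, (‖x i‖ ^ 2 + ‖y i‖ ^ 2) := by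
  have hyx : ∀ i j, inner ℂ (y i) (x j) = inner ℂ (y j) (x i) := fun i j => by
    rw [← inner_conj_symm, hxy, inner_conj_symm]
  rw [← Complex.ofReal_inj]
  push_cast
  simp only [← Complex.coe_algebraMap, ← inner_self_eq_norm_sq_to_K (𝕜 := ℂ), Fin.sum_univ_four]
  simp only [inner_add_left, inner_sub_left,
    inner_add_right, inner_sub_right, inner_smul_left, inner_smul_right, map_neg, hc,
    Complex.conj_I]
  linear_combination Complex.I * hx 1 0 + c * hy 2 3 + Complex.I * hy 0 1 + c * hx 3 2 +
    hxy 0 2 + hyx 2 0 + c * hxy 0 3 + c * hyx 0 3 + Complex.I * hxy 1 2 + Complex.I * hyx 1 2 +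
    Complex.I * c * hxy 1 3 + Complex.I * c * hyx 3 1 -
    (inner ℂ (x 1) (x 1) + inner ℂ (y 1) (y 1)) * Complex.I_mul_I -
    (inner ℂ (x 3) (x 3) + inner ℂ (y 3) (y 3)) * hc2

/-! ### The elliptic estimate -/

lemma inner_toLp {f g : Space Ω → ℂ} (hf : MemLp f 2) (hg : MemLp g 2) :
    inner ℂ (hf.toLp f) (hg.toLp g) = ∫ p, g p * starRingEnd ℂ (f p) := by
  rw [L2.inner_def]
  refine integral_congr_ae ?_
  filter_upwards [hf.coeFn_toLp, hg.coeFn_toLp] with p h1 h2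
  rw [h1, h2]
  rfl

lemma norm_sq_toLp {E : Type*} [NormedAddCommGroup E] [InnerProductSpace ℂ E]
    {f : Space Ω → E} (hf : MemLp f 2) :
    ‖hf.toLp f‖ ^ 2 = ∫ p, ‖f p‖ ^ 2 := by
  rw [← Complex.ofReal_inj]
  have h := inner_self_eq_norm_sq_to_K (𝕜 := ℂ) (hf.toLp f)
  rw [L2.inner_def] at h
  push_cast
  rw [← integral_complex_ofReal]
  refine h.symm.trans (integral_congr_ae ?_)
  filter_upwards [hf.coeFn_toLp] with p h1
  rw [h1, inner_self_eq_norm_sq_to_K]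
  simp

/-- The combination `∇_x + c ∇_y` of the covariant derivatives along `T`, where `z = x + iy`. -/
def covZ (ξ : ℂ →L[ℝ] ℝ) (c : ℂ) (f : Space Ω → ℂ) (p : Space Ω) : ℂ :=
  covDeriv ξ (1, 0) f p + c * covDeriv ξ (Complex.I, 0) f p

/-- The combination `∇_u + c ∇_v` of the covariant derivatives along `ℂ`, where `w = u + iv`. -/
def covW (ξ : ℂ →L[ℝ] ℝ) (c : ℂ) (f : Space Ω → ℂ) (p : Space Ω) : ℂ :=
  covDeriv ξ (0, 1) f p + c * covDeriv ξ (0, Complex.I) f p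

lemma Smooth.covZ {f : Space Ω → ℂ} (hf : Smooth f) (ξ : ℂ →L[ℝ] ℝ) (c : ℂ) :
    Smooth (covZ ξ c f) :=
  (hf.covDeriv ξ _).add ((hf.covDeriv ξ _).const_mul c)

lemma Smooth.covW {f : Space Ω → ℂ} (hf : Smooth f) (ξ : ℂ →L[ℝ] ℝ) (c : ℂ) :
    Smooth (covW ξ c f) :=
  (hf.covDeriv ξ _).add ((hf.covDeriv ξ _).const_mul c)

lemma TestFunction.covZ {f : Space Ω → ℂ} (hf : TestFunction f) (ξ : ℂ →L[ℝ] ℝ) (c : ℂ) :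
    TestFunction (covZ ξ c f) :=
  (hf.covDeriv ξ _).add ((hf.covDeriv ξ _).const_mul c)

lemma TestFunction.covW {f : Space Ω → ℂ} (hf : TestFunction f) (ξ : ℂ →L[ℝ] ℝ) (c : ℂ) :
    TestFunction (covW ξ c f) :=
  (hf.covDeriv ξ _).add ((hf.covDeriv ξ _).const_mul c)

/-- The coordinate vector fields on `T × ℂ`. -/
def coordVector : Fin 4 → ℂ × ℂ := ![(1, 0), (Complex.I, 0), (0, 1), (0, Complex.I)]

lemma weitzenboeck (ξ : ℂ →L[ℝ] ℝ) {a b : Space Ω → ℂ} (ha : TestFunction a)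
    (hb : TestFunction b) {c : ℂ} (hc : starRingEnd ℂ c = -c) (hc2 : c * c = -1) :
    (∫ p, ‖covZ ξ (-Complex.I) a p + covW ξ c b p‖ ^ 2) +
      ∫ p, ‖covZ ξ Complex.I b p - covW ξ (-c) a p‖ ^ 2 =
    ∑ i, ((∫ p, ‖covDeriv ξ (coordVector i) a p‖ ^ 2) +
      ∫ p, ‖covDeriv ξ (coordVector i) b p‖ ^ 2) := by
  have hsym : ∀ {f g : Space Ω → ℂ} (hf : TestFunction f) (hg : TestFunction g) (i j : Fin 4),
      inner ℂ ((hf.covDeriv ξ (coordVector i)).memLp.toLp _)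
          ((hg.covDeriv ξ (coordVector j)).memLp.toLp _) =
        inner ℂ ((hf.covDeriv ξ (coordVector j)).memLp.toLp _)
          ((hg.covDeriv ξ (coordVector i)).memLp.toLp _) := fun hf hg i j => by
    rw [inner_toLp, inner_toLp]
    exact integral_covDeriv_mul_conj_covDeriv_comm ξ _ _ hg hf
  have h := weitzenboeck_inner
    (fun i => (ha.covDeriv ξ (coordVector i)).memLp.toLp _)
    (fun i => (hb.covDeriv ξ (coordVector i)).memLp.toLp _)
    (hsym ha ha) (hsym hb hb) (hsym ha hb) hc hc2
  simp only [norm_sq_toLp] at h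
  rw [← h, ← norm_sq_toLp ((ha.covZ ξ _).add (hb.covW ξ _)).memLp,
    ← norm_sq_toLp ((hb.covZ ξ _).sub (ha.covW ξ _)).memLp]
  rfl

/-- The torus derivatives alone control the function by Poincaré, so the plane derivatives are
discarded. -/
lemma exists_elliptic_estimate {ξ : ℂ →L[ℝ] ℝ} (hξ : ξ ∉ dualLattice Ω) :
    ∃ κ : ℝ, 0 < κ ∧ ∀ c : ℂ, starRingEnd ℂ c = -c → c * c = -1 →
      ∀ a b : Space Ω → ℂ, TestFunction a → TestFunction b →
      κ * ((∫ p, ‖a p‖ ^ 2) + ∫ p, ‖b p‖ ^ 2) ≤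
        (∫ p, ‖covZ ξ (-Complex.I) a p + covW ξ c b p‖ ^ 2) +
          ∫ p, ‖covZ ξ Complex.I b p - covW ξ (-c) a p‖ ^ 2 := by
  obtain ⟨κ, hκ, h⟩ := exists_poincare hξ
  refine ⟨κ, hκ, fun c hc hc2 a b ha hb => ?_⟩
  rw [weitzenboeck ξ ha hb hc hc2, Fin.sum_univ_four]
  have h1 := h a ha
  have h2 := h b hb
  have hn : ∀ (i : Fin 4) (f : Space Ω → ℂ),
      0 ≤ ∫ p, ‖covDeriv ξ (coordVector i) f p‖ ^ 2 :=
    fun i f => integral_nonneg fun p => by positivity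
  have := hn 2 a
  have := hn 3 a
  have := hn 2 b
  have := hn 3 b
  simp only [show coordVector 0 = (1, 0) from rfl, show coordVector 1 = (Complex.I, 0) from rfl]
  linarith

/-! ### The estimate for the Dirac operator -/

lemma testFunction_coord (s : Sections Ω) (i : Fin 2) :
    TestFunction (fun p => (s : Space Ω → Spinor) p i) :=
  ⟨contDiff_coord s.2.1 i, s.2.2.comp_left (g := fun x : Spinor => x i) rfl⟩

lemma diracFun_zero_eq (ξ : ℂ →L[ℝ] ℝ) (s : Space Ω → Spinor) (p : Space Ω) :
    diracFun ξ s p 0 =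
      covZ ξ (-Complex.I) (fun q => s q 0) p + covW ξ (-Complex.I) (fun q => s q 1) p := by
  simp only [diracFun, nablaZ, nablaW, covZ, covW, PiLp.toLp_apply, Matrix.cons_val_zero]
  ring

/-- The double negation is kept so that the right side matches `-c` in the estimate at `c = -i`. -/
lemma diracFun_one_eq (ξ : ℂ →L[ℝ] ℝ) (s : Space Ω → Spinor) (p : Space Ω) :
    diracFun ξ s p 1 =
      covZ ξ Complex.I (fun q => s q 1) p - covW ξ (- -Complex.I) (fun q => s q 0) p := by
  simp only [diracFun, nablaZbar, nablaWbar, covZ, covW, PiLp.toLp_apply, Matrix.cons_val_one,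
    Matrix.cons_val_fin_one]
  ring

lemma norm_sq_toL2 (s : Sections Ω) :
    ‖toL2 s‖ ^ 2 = (∫ p, ‖(s : Space Ω → Spinor) p 0‖ ^ 2) +
      ∫ p, ‖(s : Space Ω → Spinor) p 1‖ ^ 2 := by
  refine (norm_sq_toLp (memLp_section s)).trans ?_
  rw [← integral_add (testFunction_coord s 0).integrable_norm_sq
    (testFunction_coord s 1).integrable_norm_sq]
  congr 1
  funext p
  rw [EuclideanSpace.norm_sq_eq, Fin.sum_univ_two]

lemma exists_dirac_estimate {ξ : ℂ →L[ℝ] ℝ} (hξ : ξ ∉ dualLattice Ω) :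
    ∃ C : ℝ, 0 < C ∧ ∀ s : Sections Ω, ‖toL2 s‖ ≤ C * ‖toL2 (diracSmooth ξ s)‖ := by
  obtain ⟨κ, hκ, h⟩ := exists_elliptic_estimate hξ
  refine ⟨(√κ)⁻¹, inv_pos.2 (Real.sqrt_pos.2 hκ), fun s => ?_⟩
  rw [← div_eq_inv_mul, le_div_iff₀ (Real.sqrt_pos.2 hκ)]
  refine le_of_sq_le_sq ?_ (norm_nonneg _)
  rw [mul_pow, Real.sq_sqrt hκ.le, norm_sq_toL2, norm_sq_toL2, mul_comm]
  have h1 := h (-Complex.I) (by simp) (by simp) _ _ (testFunction_coord s 0)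
    (testFunction_coord s 1)
  simp_rw [← diracFun_zero_eq, ← diracFun_one_eq] at h1
  exact h1

lemma exists_dirac_lower_bound {ξ : ℂ →L[ℝ] ℝ} (hξ : ξ ∉ dualLattice Ω) :
    ∃ C : ℝ, 0 < C ∧ ∀ x : L21 Ω ξ, ‖x‖ ≤ C * ‖dirac Ω ξ x‖ := by
  obtain ⟨C, hC, h⟩ := exists_dirac_estimate hξ
  -- The extra `1` accounts for the summand `‖D*_ξ s‖` of the `L²₁` norm.
  refine ⟨C + 1, by positivity, fun x => ?_⟩
  refine Completion.induction_on (p := fun x : L21 Ω ξ => ‖x‖ ≤ (C + 1) * ‖dirac Ω ξ x‖) x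
    (isClosed_le continuous_norm (continuous_const.mul (dirac Ω ξ).continuous.norm))
    fun s => ?_
  rw [Completion.norm_coe, dirac_coe, norm_preL21]
  have := h s
  linarith

lemma exists_inverse_of_denseRange {ξ : ℂ →L[ℝ] ℝ} (hξ : ξ ∉ dualLattice Ω)
    (hd : DenseRange (dirac Ω ξ)) :
    ∃ Q : L2 Ω →L[ℂ] L21 Ω ξ,
      (dirac Ω ξ).comp Q = ContinuousLinearMap.id ℂ (L2 Ω) ∧
      Q.comp (dirac Ω ξ) = ContinuousLinearMap.id ℂ (L21 Ω ξ) := by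
  obtain ⟨C, hC, h⟩ := exists_dirac_lower_bound hξ
  have ha : AntilipschitzWith C.toNNReal (dirac Ω ξ) :=
    AddMonoidHomClass.antilipschitz_of_bound _ fun x => by
      rw [Real.coe_toNNReal _ hC.le]; exact h x
  have hcl : IsClosed (Set.range (dirac Ω ξ)) :=
    ha.isClosed_range (dirac Ω ξ).uniformContinuous
  have hs : Function.Surjective (dirac Ω ξ) :=
    Set.range_eq_univ.1 (hcl.closure_eq ▸ hd.closure_range)
  let e := ContinuousLinearEquiv.ofBijective (dirac Ω ξ)
    (LinearMap.ker_eq_bot.2 ha.injective) (LinearMap.range_eq_top.2 hs)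
  refine ⟨e.symm, ?_, ?_⟩
  · ext1 x
    exact e.apply_symm_apply x
  · ext1 x
    exact e.symm_apply_apply x

/-! ### Cut-off functions -/

/-- A fixed bump function on the plane. -/
def planeBump : ContDiffBump (0 : ℂ) := ⟨1, 2, one_pos, one_lt_two⟩

variable (Ω) in
/-- The cut-off function `χ(w / R)` on `T × ℂ`. -/
def cutoff (R : ℝ) (p : Space Ω) : ℂ := (planeBump (R⁻¹ • p.2) : ℝ)

lemma contDiff_planeBump_ofReal : ContDiff ℝ ∞ fun w : ℂ => ((planeBump w : ℝ) : ℂ) :=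
  Complex.ofRealCLM.contDiff.comp planeBump.contDiff

lemma testFunction_cutoff {R : ℝ} (hR : 0 < R) : TestFunction (cutoff Ω R) := by
  refine ⟨contDiff_planeBump_ofReal.comp (contDiff_snd.const_smul R⁻¹), ?_⟩
  have := compactSpace_torus (Ω := Ω)
  refine HasCompactSupport.intro
    (K := (Set.univ : Set (Torus Ω)) ×ˢ Metric.closedBall (0 : ℂ) (2 * R))
    (isCompact_univ.prod (isCompact_closedBall _ _)) fun p hp => ?_
  have hp2 : 2 * R < ‖p.2‖ := by simpa using hp
  rw [cutoff, planeBump.zero_of_le_dist, Complex.ofReal_zero]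
  rw [dist_zero_right, norm_smul, norm_inv, Real.norm_of_nonneg hR.le, ← div_eq_inv_mul,
    le_div_iff₀ hR]
  exact hp2.le

lemma norm_cutoff_le_one (R : ℝ) (p : Space Ω) : ‖cutoff Ω R p‖ ≤ 1 := by
  rw [cutoff, Complex.norm_real, Real.norm_of_nonneg planeBump.nonneg]
  exact planeBump.le_one

lemma cutoff_eq_one {R : ℝ} (hR : 0 < R) {p : Space Ω} (hp : ‖p.2‖ ≤ R) :
    cutoff Ω R p = 1 := by
  rw [cutoff, planeBump.one_of_mem_closedBall, Complex.ofReal_one]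
  rw [mem_closedBall_zero_iff, norm_smul, norm_inv, Real.norm_of_nonneg hR.le, ← div_eq_inv_mul]
  exact (div_le_one hR).2 hp

lemma dirDeriv_cutoff (R : ℝ) (v : ℂ × ℂ) (p : Space Ω) :
    dirDeriv v (cutoff Ω R) p =
      fderiv ℝ (fun w : ℂ => ((planeBump w : ℝ) : ℂ)) (R⁻¹ • p.2) (R⁻¹ • v.2) := by
  have hl : HasDerivAt (fun t : ℝ => R⁻¹ • (p.2 + t • v.2)) (R⁻¹ • v.2) 0 := by
    have h := (((hasDerivAt_id (0 : ℝ)).smul_const v.2).const_add p.2).const_smul R⁻¹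
    rwa [one_smul] at h
  have hb : HasFDerivAt (fun w : ℂ => ((planeBump w : ℝ) : ℂ))
      (fderiv ℝ (fun w : ℂ => ((planeBump w : ℝ) : ℂ)) (R⁻¹ • p.2))
      (R⁻¹ • (p.2 + (0 : ℝ) • v.2)) := by
    rw [zero_smul, add_zero]
    exact (contDiff_planeBump_ofReal.differentiable (by simp) _).hasFDerivAt
  exact (hb.comp_hasDerivAt 0 hl).deriv

-- The bound `C` is that of the derivative of the fixed bump; rescaling contributes `1/R`.
variable (Ω) in
lemma exists_norm_dirDeriv_cutoff_le :
    ∃ C : ℝ, 0 ≤ C ∧ ∀ R : ℝ, 0 < R → ∀ (v : ℂ × ℂ) (p : Space Ω),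
      ‖dirDeriv v (cutoff Ω R) p‖ ≤ C / R * ‖v.2‖ := by
  obtain ⟨C, hC⟩ :=
    (contDiff_planeBump_ofReal.continuous_fderiv (by simp)).bounded_above_of_compact_support
    ((planeBump.hasCompactSupport.comp_left (g := fun x : ℝ => (x : ℂ)) rfl).fderiv (𝕜 := ℝ))
  refine ⟨C, (norm_nonneg _).trans (hC 0), fun R hR v p => ?_⟩
  rw [dirDeriv_cutoff]
  refine (ContinuousLinearMap.le_of_opNorm_le _ (hC _) _).trans (le_of_eq ?_)
  rw [norm_smul, norm_inv, Real.norm_of_nonneg hR.le]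
  ring

/-- A smooth function which is orthogonal to all test functions vanishes. -/
lemma Smooth.eq_zero_of_integral {h : Space Ω → ℂ} (hh : Smooth h)
    (h0 : ∀ a : Space Ω → ℂ, TestFunction a → ∫ p, h p * starRingEnd ℂ (a p) = 0)
    (p : Space Ω) : h p = 0 := by
  by_contra hp
  set R : ℝ := ‖p.2‖ + 1
  have hR : 0 < R := by positivity
  -- Testing `h` against `χ h` gives the integral of `χ|h|²`, which is positive at `p` because `R`
  -- exceeds `‖p.2‖`.
  set k : Space Ω → ℝ := fun q => planeBump (R⁻¹ • q.2) * ‖h q‖ ^ 2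
  have hk : ∀ q, (k q : ℂ) = h q * starRingEnd ℂ (cutoff Ω R q * h q) := by
    intro q
    simp only [k, cutoff, map_mul, Complex.conj_ofReal]
    push_cast
    rw [← Complex.conj_mul']
    ring
  have hint : ∫ q, k q = 0 := by
    rw [← Complex.ofReal_inj, ← integral_complex_ofReal]
    simp_rw [hk]
    exact h0 _ ((testFunction_cutoff hR).mul_right hh)
  have hkc : Continuous k := (planeBump.continuous.comp (continuous_snd.const_smul R⁻¹)).mul
    (hh.continuous.norm.pow 2)
  have hks : HasCompactSupport k := by
    refine (testFunction_cutoff (Ω := Ω) hR).2.mono fun q hq => ?_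
    simp only [Function.mem_support, k, cutoff, ne_eq, mul_eq_zero, not_or,
      Complex.ofReal_eq_zero] at hq ⊢
    exact hq.1
  refine hint.not_gt (hkc.integral_pos_of_hasCompactSupport_nonneg_nonzero hks
    (fun q => mul_nonneg planeBump.nonneg (by positivity)) (x := p) ?_)
  have h1 := cutoff_eq_one (Ω := Ω) hR (p := p) (by simp [R])
  rw [cutoff, Complex.ofReal_eq_one] at h1
  simp only [k, h1, one_mul]
  positivity

/-! ### Square-integrable solutions of the adjoint equation -/

/-- The cut-off is constant along `T`. -/
lemma covZ_cutoff_mul (ξ : ℂ →L[ℝ] ℝ) (c : ℂ) {R : ℝ} (hR : 0 < R) {f : Space Ω → ℂ}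
    (hf : Smooth f) (p : Space Ω) :
    covZ ξ c (fun q => cutoff Ω R q * f q) p = cutoff Ω R p * covZ ξ c f p := by
  have h := (testFunction_cutoff (Ω := Ω) hR).1
  simp only [covZ, covDeriv_mul ξ h hf, dirDeriv_cutoff, smul_zero, map_zero]
  ring

lemma covW_cutoff_mul (ξ : ℂ →L[ℝ] ℝ) (c : ℂ) {R : ℝ} (hR : 0 < R) {f : Space Ω → ℂ}
    (hf : Smooth f) (p : Space Ω) :
    covW ξ c (fun q => cutoff Ω R q * f q) p =
      (dirDeriv (0, 1) (cutoff Ω R) p + c * dirDeriv (0, Complex.I) (cutoff Ω R) p) * f p +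
        cutoff Ω R p * covW ξ c f p := by
  have h := (testFunction_cutoff (Ω := Ω) hR).1
  simp only [covW, covDeriv_mul ξ h hf]
  ring

lemma tendsto_integral_cutoff_mul {f : Space Ω → ℂ} (hf : Smooth f) (hf2 : MemLp f 2) :
    Filter.Tendsto (fun n : ℕ => ∫ p, ‖cutoff Ω (n + 1) p * f p‖ ^ 2) Filter.atTop
      (nhds (∫ p, ‖f p‖ ^ 2)) := by
  refine tendsto_integral_of_dominated_convergence (fun p => ‖f p‖ ^ 2) (fun n => ?_)
    (hf2.integrable_norm_pow (by norm_num)) (fun n => ?_) ?_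
  · exact (((testFunction_cutoff (by positivity)).continuous.mul
      hf.continuous).norm.pow 2).aestronglyMeasurable
  · refine Filter.Eventually.of_forall fun p => ?_
    rw [norm_pow, norm_norm, norm_mul]
    exact pow_le_pow_left₀ (by positivity)
      (mul_le_of_le_one_left (norm_nonneg _) (norm_cutoff_le_one _ p)) 2
  · refine Filter.Eventually.of_forall fun p => ?_
    refine tendsto_const_nhds.congr' ?_
    obtain ⟨N, hN⟩ := exists_nat_ge ‖p.2‖
    filter_upwards [Filter.eventually_ge_atTop N] with n hn
    have : (N : ℝ) ≤ n := by exact_mod_cast hn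
    rw [cutoff_eq_one (by positivity) (by linarith), one_mul]

lemma integral_norm_sq_le_of_norm_le {f g : Space Ω → ℂ} {C : ℝ} (hf : TestFunction f)
    (hg : MemLp g 2) (h : ∀ p, ‖f p‖ ≤ C * ‖g p‖) :
    ∫ p, ‖f p‖ ^ 2 ≤ C ^ 2 * ∫ p, ‖g p‖ ^ 2 := by
  rw [← integral_const_mul]
  refine integral_mono hf.integrable_norm_sq
    ((hg.integrable_norm_pow (p := 2) (by norm_num)).const_mul _) fun p => ?_
  simpa [mul_pow] using pow_le_pow_left₀ (norm_nonneg _) (h p) 2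

lemma Smooth.eq_zero_of_integral_norm_sq {f : Space Ω → ℂ} (hf : Smooth f) (hf2 : MemLp f 2)
    (h : ∫ p, ‖f p‖ ^ 2 = 0) (p : Space Ω) : f p = 0 := by
  have h1 := (integral_eq_zero_iff_of_nonneg (fun p => by positivity)
    (hf2.integrable_norm_pow (p := 2) (by norm_num))).1 h
  have h2 := (Continuous.ae_eq_iff_eq _ (hf.continuous.norm.pow 2) continuous_const).1 h1
  exact norm_eq_zero.1 (pow_eq_zero_iff two_ne_zero |>.1 (congrFun h2 p))

/-- The elliptic estimate needs compact support, so it is applied to `χ_R a, χ_R b`. The equations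
leave only terms with a derivative of `χ_R`, which are `O(1/R)` in `L²`; let `R → ∞`. -/
lemma eq_zero_of_adjoint {ξ : ℂ →L[ℝ] ℝ} (hξ : ξ ∉ dualLattice Ω) {a b : Space Ω → ℂ}
    (ha : Smooth a) (hb : Smooth b) (ha2 : MemLp a 2) (hb2 : MemLp b 2)
    (h0 : ∀ p, covZ ξ (-Complex.I) a p + covW ξ Complex.I b p = 0)
    (h1 : ∀ p, covZ ξ Complex.I b p - covW ξ (-Complex.I) a p = 0) (p : Space Ω) :
    a p = 0 ∧ b p = 0 := by
  obtain ⟨κ, hκ, hell⟩ := exists_elliptic_estimate hξ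
  obtain ⟨C, hC, hcut⟩ := exists_norm_dirDeriv_cutoff_le Ω
  have hδ : ∀ (c : ℂ), ‖c‖ = 1 → ∀ R : ℝ, 0 < R → ∀ p : Space Ω,
      ‖dirDeriv (0, 1) (cutoff Ω R) p + c * dirDeriv (0, Complex.I) (cutoff Ω R) p‖ ≤
        2 * C / R := by
    intro c hc R hR p
    refine (norm_add_le _ _).trans ?_
    have e1 := hcut R hR (0, 1) p
    have e2 := hcut R hR (0, Complex.I) p
    rw [norm_mul, hc]
    simp only [norm_one, Complex.norm_I] at e1 e2
    linarith [show 2 * C / R = C / R + C / R by ring]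
  have key : ∀ R : ℝ, 0 < R →
      κ * ((∫ p, ‖cutoff Ω R p * a p‖ ^ 2) + ∫ p, ‖cutoff Ω R p * b p‖ ^ 2) ≤
        (2 * C / R) ^ 2 * ((∫ p, ‖b p‖ ^ 2) + ∫ p, ‖a p‖ ^ 2) := by
    intro R hR
    have hχ := testFunction_cutoff (Ω := Ω) hR
    have hχa := hχ.mul_right ha
    have hχb := hχ.mul_right hb
    refine (hell Complex.I (by simp) (by simp) _ _ hχa hχb).trans ?_
    rw [mul_add]
    refine add_le_add
      (integral_norm_sq_le_of_norm_le ((hχa.covZ ξ _).add (hχb.covW ξ _)) hb2 fun p => ?_)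
      (integral_norm_sq_le_of_norm_le ((hχb.covZ ξ _).sub (hχa.covW ξ _)) ha2 fun p => ?_)
    · rw [covZ_cutoff_mul ξ _ hR ha, covW_cutoff_mul ξ _ hR hb, add_left_comm, ← mul_add, h0,
        mul_zero, add_zero, norm_mul]
      exact mul_le_mul_of_nonneg_right (hδ _ (by simp) R hR p) (norm_nonneg _)
    · rw [covZ_cutoff_mul ξ _ hR hb, covW_cutoff_mul ξ _ hR ha, add_comm, ← sub_sub, ← mul_sub, h1,
        mul_zero, zero_sub, norm_neg, norm_mul]
      exact mul_le_mul_of_nonneg_right (hδ _ (by simp) R hR p) (norm_nonneg _)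
  have hlim : Filter.Tendsto (fun n : ℕ => (2 * C / ((n : ℝ) + 1)) ^ 2 *
      ((∫ p, ‖b p‖ ^ 2) + ∫ p, ‖a p‖ ^ 2)) Filter.atTop (nhds 0) := by
    have h := (tendsto_one_div_add_atTop_nhds_zero_nat (𝕜 := ℝ)).const_mul (2 * C)
    have h' := (h.pow 2).mul_const ((∫ p, ‖b p‖ ^ 2) + ∫ p, ‖a p‖ ^ 2)
    simpa [div_eq_mul_inv] using h'
  have hle := le_of_tendsto_of_tendsto' (((tendsto_integral_cutoff_mul ha ha2).add
    (tendsto_integral_cutoff_mul hb hb2)).const_mul κ) hlim fun n => key (n + 1) (by positivity)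
  have hna : 0 ≤ ∫ p, ‖a p‖ ^ 2 := integral_nonneg fun p => by positivity
  have hnb : 0 ≤ ∫ p, ‖b p‖ ^ 2 := integral_nonneg fun p => by positivity
  have hsum := nonpos_of_mul_nonpos_right hle hκ
  exact ⟨ha.eq_zero_of_integral_norm_sq ha2 (by linarith) p,
    hb.eq_zero_of_integral_norm_sq hb2 (by linarith) p⟩

/-! ### Mollification -/

/-- The convolution of a function on `T × ℂ` with a function on its universal cover. -/
def mollify (g : ℂ × ℂ → ℝ) (f : Space Ω → ℂ) (p : Space Ω) : ℂ :=
  ∫ v : ℂ × ℂ, (g v : ℂ) * f (p - proj v)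

section

variable {g : ℂ × ℂ → ℝ} {f : Space Ω → ℂ}

/-- On the universal cover this is the ordinary convolution of `g` with the locally integrable lift
of `f`. -/
lemma smooth_mollify (hg : ContDiff ℝ ∞ g) (hgs : HasCompactSupport g) (hf : MemLp f 2) :
    Smooth (mollify g f) := by
  have h := hgs.contDiff_convolution_left (μ := volume) (ContinuousLinearMap.lsmul ℝ ℝ) hg
    (locallyIntegrable_lift hf)
  refine (congrArg (ContDiff ℝ ∞) (funext fun q => ?_)).mpr h
  rw [lift_apply, mollify, convolution]
  congr 1

lemma stronglyMeasurable_comp_sub_proj (hf : StronglyMeasurable f) :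
    StronglyMeasurable fun x : Space Ω × (ℂ × ℂ) => f (x.1 - proj x.2) :=
  hf.comp_measurable (continuous_fst.sub (continuous_proj.comp continuous_snd)).measurable

lemma integrable_mollify_sq (hg : Continuous g) (hgs : HasCompactSupport g)
    (hfm : StronglyMeasurable f) (hf : MemLp f 2) :
    Integrable (fun x : Space Ω × (ℂ × ℂ) => |g x.2| * ‖f (x.1 - proj x.2)‖ ^ 2)
      ((volume : Measure (Space Ω)).prod volume) := by
  have hsq : Integrable fun p => ‖f p‖ ^ 2 := hf.integrable_norm_pow (by norm_num)
  rw [integrable_prod_iff']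
  · refine ⟨Filter.Eventually.of_forall fun v => (hsq.comp_sub_right (proj v)).const_mul |g v|, ?_⟩
    have : (fun v => ∫ p : Space Ω, ‖|g v| * ‖f (p - proj v)‖ ^ 2‖) =
        fun v => |g v| * ∫ p, ‖f p‖ ^ 2 := by
      funext v
      simp only [norm_mul, norm_pow, Real.norm_eq_abs, abs_abs, abs_norm]
      rw [integral_const_mul, integral_sub_right_eq_self (fun p => ‖f p‖ ^ 2)]
    simp only
    rw [this]
    exact (hg.abs.integrable_of_hasCompactSupport (hgs.comp_left abs_zero)).mul_const _
  · exact ((hg.comp continuous_snd).abs.aestronglyMeasurable).mul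
      ((stronglyMeasurable_comp_sub_proj hfm).norm.pow 2).aestronglyMeasurable

/-- A form of Young's inequality: pointwise `|g * f|² ≤ (A + 1) (|g| * |f|²)`, and the right side is
integrable by Fubini. -/
lemma memLp_mollify (hg : ContDiff ℝ ∞ g) (hgs : HasCompactSupport g)
    (hfm : StronglyMeasurable f) (hf : MemLp f 2) : MemLp (mollify g f) 2 := by
  have hcont := (smooth_mollify hg hgs hf).continuous
  have hint := integrable_mollify_sq hg.continuous hgs hfm hf
  set A := ∫ v, |g v|
  have hA0 : 0 ≤ A := integral_nonneg fun v => abs_nonneg _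
  have hgi : Integrable fun v => |g v| :=
    hg.continuous.abs.integrable_of_hasCompactSupport (hgs.comp_left abs_zero)
  rw [memLp_two_iff_integrable_sq_norm hcont.aestronglyMeasurable]
  refine (hint.integral_prod_left.const_mul (A + 1)).mono'
    (hcont.norm.pow 2).aestronglyMeasurable ?_
  filter_upwards [hint.prod_right_ae] with p hp
  rw [norm_pow, norm_norm]
  set m := ‖mollify g f p‖
  have hm : m ≤ ∫ v, |g v| * ‖f (p - proj v)‖ := by
    refine (norm_integral_le_integral_norm _).trans (le_of_eq ?_)
    simp only [norm_mul, Complex.norm_real, Real.norm_eq_abs]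
  have hm1 : Integrable fun v => |g v| * ‖f (p - proj v)‖ := by
    refine (hp.add hgi).mono' ?_ (Filter.Eventually.of_forall fun v => ?_)
    · exact (hg.continuous.abs.aestronglyMeasurable).mul (hfm.comp_measurable
        (continuous_const.sub continuous_proj).measurable).norm.aestronglyMeasurable
    · rw [Real.norm_of_nonneg (by positivity), Pi.add_apply]
      nlinarith [abs_nonneg (g v), mul_nonneg (abs_nonneg (g v))
        (sq_nonneg (‖f (p - proj v)‖ - 1)),
        mul_nonneg (abs_nonneg (g v)) (sq_nonneg ‖f (p - proj v)‖)]
  -- Integrate `|g| ((A + 1)|f| - m)² ≥ 0`. Using `A + 1` in place of `A` allows the final division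
  -- even if `g = 0`.
  have hle : ∫ v, 2 * ((A + 1) * m) * (|g v| * ‖f (p - proj v)‖) ≤
      ∫ v, ((A + 1) ^ 2 * (|g v| * ‖f (p - proj v)‖ ^ 2) + m ^ 2 * |g v|) := by
    refine integral_mono (hm1.const_mul _) ((hp.const_mul _).add (hgi.const_mul _)) fun v => ?_
    have := mul_nonneg (abs_nonneg (g v)) (sq_nonneg ((A + 1) * ‖f (p - proj v)‖ - m))
    simp only
    linarith
  rw [integral_const_mul, integral_add (hp.const_mul _) (hgi.const_mul _), integral_const_mul,
    integral_const_mul] at hle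
  have hm0 : 0 ≤ m := norm_nonneg _
  have h1 : 2 * ((A + 1) * m) * m ≤
      (A + 1) ^ 2 * (∫ v, |g v| * ‖f (p - proj v)‖ ^ 2) + m ^ 2 * A :=
    (mul_le_mul_of_nonneg_left hm (by positivity)).trans hle
  have h2 : (A + 1) * m ^ 2 ≤ (A + 1) * ((A + 1) * ∫ v, |g v| * ‖f (p - proj v)‖ ^ 2) := by
    nlinarith
  exact le_of_mul_le_mul_left h2 (by positivity)

lemma integrable_mollify_mul_conj (hg : Continuous g) (hgs : HasCompactSupport g)
    (hfm : StronglyMeasurable f) (hf : MemLp f 2) {φ : Space Ω → ℂ} (hφ : TestFunction φ) :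
    Integrable (Function.uncurry fun (p : Space Ω) (v : ℂ × ℂ) =>
      (g v : ℂ) * f (p - proj v) * starRingEnd ℂ (φ p))
      ((volume : Measure (Space Ω)).prod volume) := by
  have h1 := integrable_mollify_sq hg hgs hfm hf
  have h2 : Integrable (fun x : Space Ω × (ℂ × ℂ) => ‖φ x.1‖ ^ 2 * |g x.2|)
      ((volume : Measure (Space Ω)).prod volume) :=
    hφ.integrable_norm_sq.mul_prod
      (hg.abs.integrable_of_hasCompactSupport (hgs.comp_left abs_zero))
  refine (h1.add h2).mono' ?_ (Filter.Eventually.of_forall fun x => ?_)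
  · exact ((Complex.continuous_ofReal.comp (hg.comp continuous_snd)).aestronglyMeasurable.mul
      (stronglyMeasurable_comp_sub_proj hfm).aestronglyMeasurable).mul
      (hφ.conj.continuous.comp continuous_fst).aestronglyMeasurable
  · obtain ⟨p, v⟩ := x
    simp only [Function.uncurry_apply_pair, norm_mul, Complex.norm_real, Real.norm_eq_abs,
      RCLike.norm_conj, Pi.add_apply]
    have h := mul_nonneg (abs_nonneg (g v)) (sq_nonneg (‖f (p - proj v)‖ - ‖φ p‖))
    have h' := mul_nonneg (abs_nonneg (g v))
      (add_nonneg (sq_nonneg ‖f (p - proj v)‖) (sq_nonneg ‖φ p‖))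
    nlinarith

lemma integral_translate_mul_conj (f φ : Space Ω → ℂ) (v : ℂ × ℂ) :
    ∫ p, (g v : ℂ) * f (p - proj v) * starRingEnd ℂ (φ p) =
      g v * ∫ p, f p * starRingEnd ℂ (φ (p + proj v)) := by
  rw [← integral_const_mul, ← integral_add_right_eq_self _ (proj v : Space Ω)]
  simp only [add_sub_cancel_right, mul_assoc]

/-- Fubini moves the translations onto the test function, so weak equations survive mollification.
-/
lemma integral_mollify_mul_conj (hg : Continuous g) (hgs : HasCompactSupport g)
    (hfm : StronglyMeasurable f) (hf : MemLp f 2) {φ : Space Ω → ℂ} (hφ : TestFunction φ) :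
    ∫ p, mollify g f p * starRingEnd ℂ (φ p) =
      ∫ v, g v * ∫ p, f p * starRingEnd ℂ (φ (p + proj v)) := by
  simp_rw [mollify, ← integral_mul_const]
  rw [integral_integral_swap (integrable_mollify_mul_conj hg hgs hfm hf hφ)]
  simp_rw [integral_translate_mul_conj]

lemma integrable_integral_translate (hg : Continuous g) (hgs : HasCompactSupport g)
    (hfm : StronglyMeasurable f) (hf : MemLp f 2) {φ : Space Ω → ℂ} (hφ : TestFunction φ) :
    Integrable fun v => g v * ∫ p, f p * starRingEnd ℂ (φ (p + proj v)) := by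
  have h := (integrable_mollify_mul_conj hg hgs hfm hf hφ).integral_prod_right
  simpa only [Function.uncurry_apply_pair, integral_translate_mul_conj] using h

end

/-- If all mollifications of a square-integrable function vanish, then so does the function. -/
lemma ae_eq_zero_of_mollify {f : Space Ω → ℂ} (hfm : StronglyMeasurable f) (hf : MemLp f 2)
    (h : ∀ g : ℂ × ℂ → ℝ, ContDiff ℝ ∞ g → HasCompactSupport g → mollify g f 0 = 0) :
    ∀ᵐ p, f p = 0 := by
  have hl : ∀ᵐ q : ℂ × ℂ, lift f q = 0 := by
    refine ae_eq_zero_of_integral_contDiff_smul_eq_zero (locallyIntegrable_lift hf)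
      fun g hg hgs => ?_
    -- At the origin the convolution evaluates `f` at `-v`, hence the reflected kernel.
    have h0 := h (fun v => g (-v)) (hg.comp contDiff_neg) (hgs.comp_homeomorph (Homeomorph.neg _))
    rw [mollify] at h0
    rw [← h0, ← integral_neg_eq_self]
    congr 1
    funext v
    rw [lift_apply, map_neg, zero_sub, Complex.real_smul]
  have hms : MeasurableSet {p | f p = 0} :=
    measurableSet_eq_fun hfm.measurable measurable_const
  rw [← (measurePreserving_proj (Ω := Ω)).map_eq,
    ae_map_iff measurePreserving_proj.measurable.aemeasurable hms]
  refine Measure.AbsolutelyContinuous.ae_le ?_ hl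
  exact Measure.absolutelyContinuous_of_le
    (Measure.prod_mono Measure.restrict_le_self le_rfl)

/-! ### Weak solutions of the adjoint equation -/

lemma integral_mul_conj_covZ (ξ : ℂ →L[ℝ] ℝ) (c : ℂ) {f a : Space Ω → ℂ} (hf : Smooth f)
    (ha : TestFunction a) :
    ∫ p, f p * starRingEnd ℂ (covZ ξ c a p) =
      -∫ p, covZ ξ (starRingEnd ℂ c) f p * starRingEnd ℂ (a p) := by
  have h1 := integral_covDeriv_mul_conj ξ (1, 0) hf ha
  have h2 := integral_covDeriv_mul_conj ξ (Complex.I, 0) hf ha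
  have i1 := fun v => ((ha.covDeriv ξ v).conj.mul_left hf).integrable
  have i2 := fun v => (ha.conj.mul_left (hf.covDeriv ξ v)).integrable
  simp only [covZ, map_add, map_mul, mul_add, add_mul, mul_left_comm _ (starRingEnd ℂ c),
    mul_assoc]
  rw [integral_add (i1 _) ((i1 _).const_mul _), integral_add (i2 _) ((i2 _).const_mul _),
    integral_const_mul, integral_const_mul, h1, h2]
  ring

lemma integral_mul_conj_covW (ξ : ℂ →L[ℝ] ℝ) (c : ℂ) {f a : Space Ω → ℂ} (hf : Smooth f)
    (ha : TestFunction a) :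
    ∫ p, f p * starRingEnd ℂ (covW ξ c a p) =
      -∫ p, covW ξ (starRingEnd ℂ c) f p * starRingEnd ℂ (a p) := by
  have h1 := integral_covDeriv_mul_conj ξ (0, 1) hf ha
  have h2 := integral_covDeriv_mul_conj ξ (0, Complex.I) hf ha
  have i1 := fun v => ((ha.covDeriv ξ v).conj.mul_left hf).integrable
  have i2 := fun v => (ha.conj.mul_left (hf.covDeriv ξ v)).integrable
  simp only [covW, map_add, map_mul, mul_add, add_mul, mul_left_comm _ (starRingEnd ℂ c),
    mul_assoc]
  rw [integral_add (i1 _) ((i1 _).const_mul _), integral_add (i2 _) ((i2 _).const_mul _),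
    integral_const_mul, integral_const_mul, h1, h2]
  ring

lemma covZ_translate (ξ : ℂ →L[ℝ] ℝ) (c : ℂ) (f : Space Ω → ℂ) (d p : Space Ω) :
    covZ ξ c (fun q => f (q + d)) p = covZ ξ c f (p + d) := by
  simp only [covZ, covDeriv_translate]

lemma covW_translate (ξ : ℂ →L[ℝ] ℝ) (c : ℂ) (f : Space Ω → ℂ) (d p : Space Ω) :
    covW ξ c (fun q => f (q + d)) p = covW ξ c f (p + d) := by
  simp only [covW, covDeriv_translate]

/-- A weak solution of a constant coefficient first order equation becomes a strong solution after
mollification. -/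
lemma mollify_weak_solution (ξ : ℂ →L[ℝ] ℝ) (c d s : ℂ) {f₀ f₁ : Space Ω → ℂ}
    (h₀m : StronglyMeasurable f₀) (h₀ : MemLp f₀ 2) (h₁m : StronglyMeasurable f₁)
    (h₁ : MemLp f₁ 2)
    (hw : ∀ a : Space Ω → ℂ, TestFunction a →
      (∫ p, f₀ p * starRingEnd ℂ (covZ ξ c a p)) +
        s * ∫ p, f₁ p * starRingEnd ℂ (covW ξ d a p) = 0)
    {g : ℂ × ℂ → ℝ} (hg : ContDiff ℝ ∞ g) (hgs : HasCompactSupport g) (p : Space Ω) :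
    covZ ξ (starRingEnd ℂ c) (mollify g f₀) p +
      s * covW ξ (starRingEnd ℂ d) (mollify g f₁) p = 0 := by
  have hs₀ := smooth_mollify hg hgs h₀
  have hs₁ := smooth_mollify hg hgs h₁
  refine Smooth.eq_zero_of_integral (h := fun p => covZ ξ (starRingEnd ℂ c) (mollify g f₀) p +
      s * covW ξ (starRingEnd ℂ d) (mollify g f₁) p)
    ((hs₀.covZ ξ _).add ((hs₁.covW ξ _).const_mul s)) (fun a ha => ?_) p
  simp only [add_mul, mul_assoc]
  rw [integral_add (ha.conj.mul_left (hs₀.covZ ξ _)).integrable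
    ((ha.conj.mul_left (hs₁.covW ξ _)).integrable.const_mul s), integral_const_mul]
  have e₀ := integral_mul_conj_covZ ξ c hs₀ ha
  have e₁ := integral_mul_conj_covW ξ d hs₁ ha
  rw [integral_mollify_mul_conj hg.continuous hgs h₀m h₀ (ha.covZ ξ c)] at e₀
  rw [integral_mollify_mul_conj hg.continuous hgs h₁m h₁ (ha.covW ξ d)] at e₁
  rw [← neg_eq_zero, neg_add, ← mul_neg, ← e₀, ← e₁, ← integral_const_mul, ← integral_add
    (integrable_integral_translate hg.continuous hgs h₀m h₀ (ha.covZ ξ c))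
    ((integrable_integral_translate hg.continuous hgs h₁m h₁ (ha.covW ξ d)).const_mul s)]
  refine integral_eq_zero_of_ae (Filter.Eventually.of_forall fun v => ?_)
  -- For each `v`, the integrand is `g v` times the weak equation tested on a translate of `a`.
  have h := hw _ (ha.translate (proj v))
  simp_rw [covZ_translate, covW_translate] at h
  simp only [Pi.zero_apply]
  linear_combination (g v : ℂ) * h

/-! ### Density of the range -/

/-- The section with the given components. -/
def mkSection {a b : Space Ω → ℂ} (ha : TestFunction a) (hb : TestFunction b) : Sections Ω :=
  ⟨fun p => !₂[a p, b p], by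
    constructor
    · refine (contDiff_piLp (𝕜 := ℝ) 2).2 fun i => ?_
      fin_cases i
      · exact ha.1
      · exact hb.1
    · have h : HasCompactSupport fun p => (a p, b p) := by
        refine (ha.2.union hb.2).of_isClosed_subset (isClosed_tsupport _) ?_
        rw [tsupport, tsupport, tsupport, ← closure_union]
        refine closure_mono fun p hp => ?_
        by_contra hn
        simp only [Set.mem_union, Function.mem_support, not_or, not_not] at hn
        exact hp (Prod.ext hn.1 hn.2)
      exact h.comp_left (g := fun x : ℂ × ℂ => (!₂[x.1, x.2] : Spinor))
        (by ext i; fin_cases i <;> rfl)⟩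

lemma inner_toL2 (s : Sections Ω) (f : L2 Ω) (h₀ : MemLp (fun p => f p 0) 2)
    (h₁ : MemLp (fun p => f p 1) 2) :
    inner ℂ (toL2 s) f =
      (∫ p, f p 0 * starRingEnd ℂ ((s : Space Ω → Spinor) p 0)) +
        ∫ p, f p 1 * starRingEnd ℂ ((s : Space Ω → Spinor) p 1) := by
  have hi : ∀ {φ ψ : Space Ω → ℂ}, MemLp φ 2 → MemLp ψ 2 →
      Integrable fun p => φ p * starRingEnd ℂ (ψ p) := fun h h' => by
    exact h.integrable_mul h'.star
  rw [L2.inner_def, ← integral_add (hi h₀ (testFunction_coord s 0).memLp)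
    (hi h₁ (testFunction_coord s 1).memLp)]
  refine integral_congr_ae ?_
  filter_upwards [(memLp_section s).coeFn_toLp] with p hp
  rw [show (toL2 s : Space Ω → Spinor) p = (s : Space Ω → Spinor) p from hp,
    PiLp.inner_apply, Fin.sum_univ_two]
  rfl

lemma eq_zero_of_orthogonal {ξ : ℂ →L[ℝ] ℝ} (hξ : ξ ∉ dualLattice Ω) (f : L2 Ω)
    (hf : ∀ s : Sections Ω, inner ℂ (toL2 (diracSmooth ξ s)) f = 0) : f = 0 := by
  have hm : ∀ i, StronglyMeasurable fun p => f p i := fun i =>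
    ((continuous_apply i).comp (PiLp.continuous_ofLp 2 _)).comp_stronglyMeasurable
      (Lp.stronglyMeasurable f)
  have h2 : ∀ i, MemLp (fun p => f p i) 2 := fun i =>
    (Lp.memLp f).of_le (hm i).aestronglyMeasurable
      (Filter.Eventually.of_forall fun p => PiLp.norm_apply_le (f p) i)
  have hweak : ∀ a b : Space Ω → ℂ, TestFunction a → TestFunction b →
      (∫ p, f p 0 * starRingEnd ℂ (covZ ξ (-Complex.I) a p + covW ξ (-Complex.I) b p)) +
        ∫ p, f p 1 * starRingEnd ℂ (covZ ξ Complex.I b p - covW ξ (- -Complex.I) a p) = 0 := by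
    intro a b ha hb
    have h := hf (mkSection ha hb)
    rw [inner_toL2 _ _ (h2 0) (h2 1)] at h
    change (∫ p, f p 0 * starRingEnd ℂ (diracFun ξ (mkSection ha hb) p 0)) +
      ∫ p, f p 1 * starRingEnd ℂ (diracFun ξ (mkSection ha hb) p 1) = 0 at h
    simp_rw [diracFun_zero_eq, diracFun_one_eq] at h
    exact h
  -- Testing with one component zero splits the weak equation into two scalar ones.
  have hz : TestFunction (0 : Space Ω → ℂ) := ⟨contDiff_const, HasCompactSupport.zero⟩
  have hzZ : ∀ c p, covZ ξ c (0 : Space Ω → ℂ) p = 0 := fun c p => by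
    simp [covZ, covDeriv, dirDeriv]
  have hzW : ∀ c p, covW ξ c (0 : Space Ω → ℂ) p = 0 := fun c p => by
    simp [covW, covDeriv, dirDeriv]
  have hmoll : ∀ g : ℂ × ℂ → ℝ, ContDiff ℝ ∞ g → HasCompactSupport g → ∀ p : Space Ω,
      -- The components are swapped so that the adjoint system takes the form of `weitzenboeck` with
      -- `c = i`.
      mollify g (fun p => f p 1) p = 0 ∧ mollify g (fun p => f p 0) p = 0 := by
    intro g hg hgs
    refine eq_zero_of_adjoint hξ (smooth_mollify hg hgs (h2 1)) (smooth_mollify hg hgs (h2 0))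
      (memLp_mollify hg hgs (hm 1) (h2 1)) (memLp_mollify hg hgs (hm 0) (h2 0))
      (fun p => ?_) (fun p => ?_)
    · have h := mollify_weak_solution ξ Complex.I (-Complex.I) 1 (hm 1) (h2 1) (hm 0) (h2 0)
        (fun b hb => by
          have h := hweak 0 b hz hb
          simp only [hzZ, hzW, zero_add, sub_zero] at h
          linear_combination h) hg hgs p
      simpa using h
    · have h := mollify_weak_solution ξ (-Complex.I) Complex.I (-1) (hm 0) (h2 0) (hm 1) (h2 1)
        (fun a ha => by
          have h := hweak a 0 ha hz
          simp only [hzZ, hzW, add_zero, zero_sub, map_neg, mul_neg, integral_neg, neg_neg] at h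
          linear_combination h) hg hgs p
      simpa [sub_eq_add_neg] using h
  have hae := fun i => ae_eq_zero_of_mollify (hm i) (h2 i)
  rw [Lp.eq_zero_iff_ae_eq_zero]
  filter_upwards [hae 0 fun g hg hgs => (hmoll g hg hgs 0).2,
    hae 1 fun g hg hgs => (hmoll g hg hgs 0).1] with p h0 h1
  ext i
  fin_cases i
  · exact h0
  · exact h1

lemma denseRange_dirac {ξ : ℂ →L[ℝ] ℝ} (hξ : ξ ∉ dualLattice Ω) : DenseRange (dirac Ω ξ) := by
  have h : (LinearMap.range (dirac Ω ξ).toLinearMap).topologicalClosure = ⊤ := by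
    rw [Submodule.topologicalClosure_eq_top_iff, Submodule.eq_bot_iff]
    intro f hf
    refine eq_zero_of_orthogonal hξ f fun s => ?_
    exact (dirac_coe ξ s) ▸ hf _ ⟨_, rfl⟩
  exact Submodule.dense_iff_topologicalClosure_eq_top.2 h

end

end FlatModel

theorem mainTheorem11 (Ω : Module.Basis (Fin 2) ℝ ℂ) (ξ : ℂ →L[ℝ] ℝ)
    (hξ : (QuotientAddGroup.mk ξ : FlatModel.DualTorus Ω) ≠ 0) :
    ∃ Q : FlatModel.L2 Ω →L[ℂ] FlatModel.L21 Ω ξ,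
      (FlatModel.dirac Ω ξ).comp Q = ContinuousLinearMap.id ℂ (FlatModel.L2 Ω) ∧
      Q.comp (FlatModel.dirac Ω ξ) = ContinuousLinearMap.id ℂ (FlatModel.L21 Ω ξ) := by
  have hξ' : ξ ∉ FlatModel.dualLattice Ω := fun h => hξ ((QuotientAddGroup.eq_zero_iff ξ).2 h)
  exact FlatModel.exists_inverse_of_denseRange hξ' (FlatModel.denseRange_dirac hξ')
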